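/- Fix $r\in\mathbb N$. Write $\oplus$ for the join of sets of natural numbers (finite objects and functions being coded as sets in a standard way). For a sequence $X$, $X\restriction_n$ is the string of its first $n$ values, and $Y\restriction_n$ is defined componentwise for a tuple $Y$ of sequences. *Cross-trees.* Call a pair $(\rho,\sigma)$, with $\rho\in 3^{<\mathbb N}$ and $\sigma=(\sigma_0,\dots,\sigma_{r-1})\in(2^{<\mathbb N})^r$, a *node* if all the $\sigma_s$ have the same length and this length is at most $|\rho|$. A *cross-tree* is a set $T$ of nodes such that every node which is a componentwise prefix of an element of $T$ belongs to $T$. A *path* of $T$ is a pair $(X,Y)\in 3^{\mathbb N}\times(2^{\mathbb N})^r$ such that $(X\restriction_n,Y\restriction_n)\in T$ for all $n$. $T$ is *left-full* if for every $X\in 3^{\mathbb N}$ there is $Y\in(2^{\mathbb N})^r$ such that $(X,Y)$ is a path of $T$. *Cross-constraint ideals.* Two colorings $u,v:\mathbb N\to k$ are *finitely compatible* if $u^{-1}(i)\cap v^{-1}(i)$ is finite for every $i<k$, and *infinitely compatible* otherwise. A *solution* of a left-full cross-tree $T$ is a pair of paths $(X^0,Y^0),(X^1,Y^1)$ of $T$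 such that $X^0,X^1$ are finitely compatible and, for every $s<r$, $Y^0_s,Y^1_s$ are infinitely compatible. A *cross-constraint ideal* is a Turing ideal $\mathcal M\subseteq\mathcal P(\mathbb N)$ (non-empty, closed under $\oplus$ and downward closed under Turing reducibility) such that every left-full cross-tree $T\in\mathcal M$ has a solution with $(X^0,Y^0)\oplus(X^1,Y^1)\in\mathcal M$. *Hyperimmunity.* A coloring $f:\mathbb N\to k$ is *hyperimmune relative to* $D\subseteq\mathbb N$ if for every $D$-computable array $(F_{n,0},\dots,F_{n,k-1})_{n\in\mathbb N}$ of $k$-tuples of pairwise disjoint finite sets (given by explicit lists of their elements) such that all elements of $\bigcup_{j<k}F_{n,j}$ are greater than $n$ for every $n$, there is $N$ such that $F_{N,j}\subseteq f^{-1}(j)$ for all $j<k$. **Theorem** (Liu, Theorem 2.1). Let $\mathcal M$ be a countable cross-constraint ideal and let $f:\mathbb N\to 3$ be hyperimmune relative to every element of $\mathcal M$. Then for every $r$-tuple $g=(g_0,\dots,g_{r-1})$ of colorings $g_s:\mathbb N\to 2$ there are infinite sets $G_0,\dots,G_{r-1}\subseteq\mathbb N$, with $g_s$ constant on $G_s$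 for every $s<r$, such that for every $Z\in\mathcal M$ the set $Z\oplus G_0\oplus\dots\oplus G_{r-1}$ computes no infinite set on which $f$ is constant. -/

import Mathlib

namespace CrossConstraint

/-! ### Turing reducibility between sets of natural numbers -/

open Classical in
/-- The characteristic function of a set, as an oracle. -/
noncomputable def chi (A : Set ℕ) : ℕ →. ℕ := fun n => Part.some (if n ∈ A then 1 else 0)

/-- `A` is computable from `B`, i.e. `A ≤_T B`. -/
def ComputableFrom (A B : Set ℕ) : Prop := TuringReducible (chi A) (chi B)

/-- The join `A ⊕ B`. -/
def join (A B : Set ℕ) : Set ℕ :=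
  {m | (∃ x ∈ A, m = 2 * x) ∨ (∃ x ∈ B, m = 2 * x + 1)}

/-- The join of a finite tuple of sets. -/
def tupleJoin {r : ℕ} (G : Fin r → Set ℕ) : Set ℕ :=
  {m | ∃ s : Fin r, ∃ x ∈ G s, m = Nat.pair s x}

/-- A Turing ideal: a non-empty family of sets that is closed under join and downward closed
under Turing reducibility. -/
structure IsTuringIdeal (M : Set (Set ℕ)) : Prop where
  nonempty : M.Nonempty
  join_mem : ∀ A ∈ M, ∀ B ∈ M, join A B ∈ M
  mem_of_computableFrom : ∀ B ∈ M, ∀ A : Set ℕ, ComputableFrom A B → A ∈ M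

/-! ### Coding finite objects, and functions with values in finite objects, by sets -/

/-- A set of finite objects, as a set of natural numbers. -/
def setCode {α : Type} [Primcodable α] (T : Set α) : Set ℕ :=
  {m | ∃ a ∈ T, m = Encodable.encode a}

/-- The graph of a function from `ℕ` to finite objects, as a set of natural numbers. -/
def graphCode {α : Type} [Primcodable α] (F : ℕ → α) : Set ℕ :=
  {m | ∃ n : ℕ, m = Nat.pair n (Encodable.encode (F n))}

/-! ### Colorings of `ℕ` -/

/-- `H` is homogeneous for the coloring `f` of the natural numbers. -/
def Homogeneous {k : ℕ} (f : ℕ → Fin k) (H : Set ℕ) : Prop :=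
  ∃ c : Fin k, ∀ x ∈ H, f x = c

/-- No color class of `f` has an infinite intersection with the class of the same color of `g`. -/
def FinitelyCompatible {k : ℕ} (f g : ℕ → Fin k) : Prop :=
  ∀ i : Fin k, {x | f x = i ∧ g x = i}.Finite

/-- The negation of finite compatibility. -/
def InfinitelyCompatible {k : ℕ} (f g : ℕ → Fin k) : Prop :=
  ¬ FinitelyCompatible f g

/-- A `D`-computable array of `k`-tuples of finite sets, the finite sets being given explicitly
(as lists of their elements). -/
def ComputableArray {k : ℕ} (D : Set ℕ) (F : ℕ → Fin k → Finset ℕ) : Prop :=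
  ∃ L : ℕ → Fin k → List ℕ, ComputableIn₂ {chi D} L ∧ ∀ n j, (L n j).toFinset = F n j

/-- The `k`-coloring `f` is hyperimmune relative to `D`: every `D`-computable array of `k`-tuples
of mutually disjoint finite sets, the `n`-th one consisting of numbers greater than `n`, has an
entry whose `j`-th set is contained in the `j`-th color class of `f`, for all `j`. -/
def Hyperimmune {k : ℕ} (f : ℕ → Fin k) (D : Set ℕ) : Prop :=
  ∀ F : ℕ → Fin k → Finset ℕ, ComputableArray D F →
    (∀ n, Pairwise fun i j => Disjoint (F n i) (F n j)) →
    (∀ n j, ∀ x ∈ F n j, n < x) →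
    ∃ N, ∀ j, ∀ x ∈ F N j, f x = j

/-! ### Cross-trees and the cross-constraint problem -/

/-- Pairs of a 3-valued string and an `r`-tuple of 2-valued strings. -/
abbrev Node (r : ℕ) : Type := List (Fin 3) × (Fin r → List (Fin 2))

/-- The componentwise prefix relation. -/
def Node.IsPrefix {r : ℕ} (χ ψ : Node r) : Prop :=
  χ.1 <+: ψ.1 ∧ ∀ s, χ.2 s <+: ψ.2 s

/-- The right strings have a common length, which is at most the length of the left string. -/
def Node.Balanced {r : ℕ} (χ : Node r) : Prop :=
  (∀ i j, (χ.2 i).length = (χ.2 j).length) ∧ ∀ i, (χ.2 i).length ≤ χ.1.length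

/-- A cross-tree: a set of balanced nodes that is closed under prefixes (among balanced nodes). -/
structure IsCrossTree {r : ℕ} (T : Set (Node r)) : Prop where
  balanced : ∀ χ ∈ T, χ.Balanced
  prefix_mem : ∀ χ ∈ T, ∀ ψ : Node r, ψ.Balanced → ψ.IsPrefix χ → ψ ∈ T

/-- The first `n` values of a sequence, as a string. -/
def initSeg {k : ℕ} (X : ℕ → Fin k) (n : ℕ) : List (Fin k) := (List.range n).map X

/-- `(X, Y)` is an infinite path through `T`. -/
def IsPath {r : ℕ} (T : Set (Node r)) (X : ℕ → Fin 3) (Y : Fin r → ℕ → Fin 2) : Prop :=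
  ∀ n, ((initSeg X n, fun s => initSeg (Y s) n) : Node r) ∈ T

/-- `T` is left-full: every `X` is the left component of a path through `T`. -/
def LeftFull {r : ℕ} (T : Set (Node r)) : Prop :=
  ∀ X : ℕ → Fin 3, ∃ Y : Fin r → ℕ → Fin 2, IsPath T X Y

/-- The instances of the cross-constraint problem. -/
def IsCCInstance {r : ℕ} (T : Set (Node r)) : Prop := IsCrossTree T ∧ LeftFull T

/-- `(X⁰, Y⁰), (X¹, Y¹)` is a solution to the instance `T` of the cross-constraint problem. -/
structure IsCCSolution {r : ℕ} (T : Set (Node r)) (X : Fin 2 → ℕ → Fin 3)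
    (Y : Fin 2 → Fin r → ℕ → Fin 2) : Prop where
  isPath : ∀ i, IsPath T (X i) (Y i)
  left : FinitelyCompatible (X 0) (X 1)
  right : ∀ s, InfinitelyCompatible (Y 0 s) (Y 1 s)

/-- The pair `(X, Y)`, as a set of natural numbers. -/
def pairCode {r : ℕ} (X : ℕ → Fin 3) (Y : Fin r → ℕ → Fin 2) : Set ℕ :=
  graphCode fun n => (X n, fun s => Y s n)

/-- A cross-constraint ideal (for `r`-tuples of 2-colorings): a Turing ideal in which every
instance of the cross-constraint problem that it contains has a solution. -/
structure IsCrossConstraintIdeal (r : ℕ) (M : Set (Set ℕ)) : Prop where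
  isTuringIdeal : IsTuringIdeal M
  exists_solution : ∀ T : Set (Node r), IsCCInstance T → setCode T ∈ M →
    ∃ (X : Fin 2 → ℕ → Fin 3) (Y : Fin 2 → Fin r → ℕ → Fin 2),
      IsCCSolution T X Y ∧ join (pairCode (X 0) (Y 0)) (pairCode (X 1) (Y 1)) ∈ M

end CrossConstraint

/-! The sets are built by a Mathias-style forcing that treats all tuples of colors at once. A
condition holds, for each `s` and each of two labels, a finite set of numbers of one color, together
with a reservoir enumerated computably in the ideal. A generic sequence of conditions yields
infinite homogeneous sets `G c s` for every `c : Fin r → Fin 2`. No particular tuple `G c` is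
promised to work. The requirements are disjunctive: given a functional, a set `Z` of the ideal and a
color for each `c`, there is some `c` at which the functional does not enumerate from `Z ⊕ G c` an
infinite set on which `f` has that color. If every `G c` failed, choosing one failure per `c` would
violate such a requirement.

For density (`Condition.isCofinal_outputs`), read the left string of a node as a guess at `f` and
the right strings as guesses at the labels of the reservoir elements. Given `N`, keep the nodes at
which no functional is seen to enumerate a number above `N` of the wrong guessed color, when its
oracle consists of the finite part and reservoir elements guessed to carry the labels `c`. This is a
cross-tree of the ideal.

If the tree is left-full for some `N`, take a solution. For each `s` the two right sides share a
color infinitely often; this picks `c`, and the reservoirs are thinned to the places of agreement.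
An output above `N` must now have the prescribed color on both left sides, and these are finitely
compatible, so the output is finite (`Task.exists_reservoir_of_leftFull`).

Otherwise compactness gives, for each `N`, a left string all of whose companions are excluded, and
such strings can be found computably in the ideal. Hyperimmunity makes one of them agree with `f`
above its `N`. The companion given by the true labels is excluded as well, so finitely many
reservoir elements force an output of the wrong color (`Task.exists_extension_of_blocked`). -/

namespace CrossConstraint

open Encodable

/-! ### Computability relative to a set of oracles -/

section Oracle

variable {α β γ δ : Type*} [Primcodable α] [Primcodable β] [Primcodable γ] [Primcodable δ]
  {O : Set (ℕ →. ℕ)}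

theorem computableIn_comp {f : β → γ} {g : α → β} (hf : ComputableIn O f)
    (hg : ComputableIn O g) : ComputableIn O fun a => f (g a) := by
  refine (Nat.RecursiveIn.comp hf hg).of_eq fun n => ?_
  cases h : decode (α := α) n <;> simp

theorem computableIn_pair {f : α → β} {g : α → γ} (hf : ComputableIn O f)
    (hg : ComputableIn O g) : ComputableIn O fun a => (f a, g a) := by
  refine (Nat.RecursiveIn.pair hf hg).of_eq fun n => ?_
  cases h : decode (α := α) n <;> simp [Seq.seq]

theorem computableIn_primrec_comp {f : β → γ} {g : α → β} (hf : Primrec f)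
    (hg : ComputableIn O g) : ComputableIn O fun a => f (g a) :=
  computableIn_comp hf.computableIn hg

/-- The table of the first values of a function is computable from the function. -/
theorem computableIn_table {F : ℕ → α} (hF : ComputableIn O F) :
    ComputableIn O fun n => (List.range n).map F := by
  have hF' : Nat.RecursiveIn O fun n => Part.some (encode (F n)) :=
    Nat.RecursiveIn.of_eq hF fun n => by simp
  -- the step appends the next value
  let g : ℕ → ℕ := fun q => encode
    (((decode (α := List α) q.unpair.1).getD []) ++ ((decode (α := α) q.unpair.2).toList))
  have hg : Nat.RecursiveIn O fun q => Part.some (g q) := by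
    have : Primrec g := by
      refine Primrec.encode.comp (Primrec.list_append.comp
        (Primrec.option_getD.comp (Primrec.decode.comp (Primrec.fst.comp Primrec.unpair))
          (Primrec.const [])) ?_)
      have h1 : Primrec fun o : Option α => o.toList :=
        (Primrec.option_casesOn Primrec.id (Primrec.const ([] : List α))
          ((Primrec.list_cons.comp Primrec.snd (Primrec.const [])).to₂)).of_eq
            fun o => by cases o <;> rfl
      exact h1.comp (Primrec.decode.comp (Primrec.snd.comp Primrec.unpair))
    exact Nat.RecursiveIn.of_eq this.computableIn fun n => by simp
  have hidx : Nat.RecursiveIn O fun q => Part.some (q.unpair.2.unpair.1) := by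
    have : Primrec fun q : ℕ => q.unpair.2.unpair.1 :=
      Primrec.fst.comp (Primrec.unpair.comp (Primrec.snd.comp Primrec.unpair))
    exact Nat.RecursiveIn.of_eq this.computableIn fun n => by simp
  have hIH : Nat.RecursiveIn O fun q => Part.some (q.unpair.2.unpair.2) := by
    have : Primrec fun q : ℕ => q.unpair.2.unpair.2 :=
      Primrec.snd.comp (Primrec.unpair.comp (Primrec.snd.comp Primrec.unpair))
    exact Nat.RecursiveIn.of_eq this.computableIn fun n => by simp
  have hz : Nat.RecursiveIn O fun _ => Part.some (encode ([] : List α)) :=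
    Nat.RecursiveIn.of_eq (ComputableIn.const (α := ℕ) (encode ([] : List α))) fun n => by simp
  have hstep := hg.comp (hIH.pair (hF'.comp hidx))
  have hrec := hz.prec hstep
  have hstart : Nat.RecursiveIn O fun n => Part.some (Nat.pair 0 n) := by
    have : Primrec fun n : ℕ => Nat.pair 0 n := Primrec₂.natPair.comp (Primrec.const 0) Primrec.id
    exact Nat.RecursiveIn.of_eq this.computableIn fun n => by simp
  refine (hrec.comp hstart).of_eq fun n => ?_
  simp only [Part.bind_eq_bind, Part.bind_some, Nat.unpair_pair, decode_nat, Part.coe_some,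
    Part.map_some]
  induction n with
  | zero => simp
  | succ n ih =>
    simp only [ih, Part.bind_some]
    simp [g, Seq.seq, List.range_succ]

/-- Unbounded search. -/
theorem computableIn_find {u : ℕ → ℕ → Bool} (hu : ComputableIn₂ O u)
    (h : ∀ a, ∃ n, u a n = true) : ComputableIn O fun a => Nat.find (h a) := by
  have h1 : ComputableIn O fun p : ℕ × ℕ => cond (u p.1 p.2) 0 1 :=
    computableIn_primrec_comp (f := fun b : Bool => cond b 0 1) (Primrec.dom_finite _) hu
  have h2 : ComputableIn O fun q : ℕ => cond (u q.unpair.1 q.unpair.2) 0 1 :=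
    computableIn_comp (g := Nat.unpair) h1 Primrec.unpair.computableIn
  have h3 : Nat.RecursiveIn O fun q : ℕ => Part.some (cond (u q.unpair.1 q.unpair.2) 0 1) :=
    Nat.RecursiveIn.of_eq h2 fun n => by simp
  refine (h3.rfind).of_eq_tot (g := fun a => encode (Nat.find (h a))) (fun a => ?_) |>.of_eq
    fun a => by simp
  refine Nat.mem_rfind.2 ⟨?_, fun {m} hm => ?_⟩
  · simp [Nat.find_spec (h a)]
  · have := Nat.find_min (h a) hm
    simp [this]

/-- Unbounded search for an object. -/
theorem exists_computableIn_search [Inhabited α] {u : ℕ → α → Bool} (hu : ComputableIn₂ O u)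
    (h : ∀ n, ∃ a, u n a = true) :
    ∃ F : ℕ → α, ComputableIn O F ∧ ∀ n, u n (F n) = true := by
  have hdec : Primrec fun w : ℕ => (decode (α := α) w).getD default :=
    Primrec.option_getD.comp Primrec.decode (Primrec.const default)
  have hcomp : ComputableIn₂ O fun (n w : ℕ) => u n ((decode (α := α) w).getD default) :=
    computableIn_comp (f := fun p : ℕ × α => u p.1 p.2) hu
      (Primrec.pair Primrec.fst (hdec.comp Primrec.snd)).computableIn
  have hex : ∀ n, ∃ w : ℕ, u n ((decode (α := α) w).getD default) = true := by
    intro n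
    obtain ⟨a, ha⟩ := h n
    exact ⟨encode a, by simpa using ha⟩
  exact ⟨_, computableIn_comp hdec.computableIn (computableIn_find hcomp hex),
    fun n => Nat.find_spec (hex n)⟩

theorem computableIn_finArrow {r : ℕ} {F : Fin r → α → β} (hF : ∀ s, ComputableIn O (F s)) :
    ComputableIn O fun a s => F s a := by
  induction r with
  | zero => exact ((ComputableIn.const (fun s : Fin 0 => s.elim0)).of_eq
      fun a => by congr 1; exact Subsingleton.elim _ _)
  | succ r ih =>
    have hc : Primrec fun q : β × (Fin r → β) => (Fin.cons q.1 q.2 : Fin (r + 1) → β) := by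
      refine Primrec.fin_curry.2 (Primrec₂.swap (Primrec.fin_curry₁.2 fun i => ?_))
      refine Fin.cases ?_ (fun j => ?_) i
      · exact Primrec.fst
      · simpa using Primrec.fin_app.comp Primrec.snd (Primrec.const j)
    have := computableIn_primrec_comp hc
      (computableIn_pair (hF 0) (ih (F := fun s => F s.succ) fun s => hF s.succ))
    refine RecursiveIn.of_eq this fun a => ?_
    congr 1
    funext s
    refine Fin.cases ?_ (fun j => ?_) s <;> simp

end Oracle

/-! ### Turing ideals and relative computability -/

section Ideal

theorem chi_apply_of_mem {A : Set ℕ} {n : ℕ} (h : n ∈ A) : chi A n = Part.some 1 := by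
  simp [chi, h]

theorem chi_apply_of_notMem {A : Set ℕ} {n : ℕ} (h : n ∉ A) : chi A n = Part.some 0 := by
  simp [chi, h]

theorem mul_two_mem_join {A B : Set ℕ} {n : ℕ} : 2 * n ∈ join A B ↔ n ∈ A := by
  constructor
  · rintro (⟨x, hx, h⟩ | ⟨x, hx, h⟩)
    · obtain rfl : n = x := by omega
      exact hx
    · omega
  · exact fun h => Or.inl ⟨n, h, rfl⟩

theorem mul_two_add_one_mem_join {A B : Set ℕ} {n : ℕ} : 2 * n + 1 ∈ join A B ↔ n ∈ B := by
  constructor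
  · rintro (⟨x, hx, h⟩ | ⟨x, hx, h⟩)
    · omega
    · obtain rfl : n = x := by omega
      exact hx
  · exact fun h => Or.inr ⟨n, h, rfl⟩

theorem recursiveIn_chi_left (A B : Set ℕ) : Nat.RecursiveIn {chi (join A B)} (chi A) := by
  have h1 : Primrec fun n : ℕ => 2 * n := Primrec.nat_mul.comp (Primrec.const 2) Primrec.id
  have h2 : Nat.RecursiveIn {chi (join A B)} fun n : ℕ => Part.some (2 * n) :=
    Nat.RecursiveIn.of_eq h1.computableIn fun n => by simp
  refine ((Nat.RecursiveIn.oracle (chi (join A B)) (Set.mem_singleton _)).comp h2).of_eq fun n => ?_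
  refine (Part.bind_some (2 * n) (chi (join A B))).trans ?_
  by_cases h : n ∈ A
  · rw [chi_apply_of_mem h, chi_apply_of_mem (mul_two_mem_join.2 h)]
  · rw [chi_apply_of_notMem h, chi_apply_of_notMem (mt mul_two_mem_join.1 h)]

theorem recursiveIn_chi_right (A B : Set ℕ) : Nat.RecursiveIn {chi (join A B)} (chi B) := by
  have h1 : Primrec fun n : ℕ => 2 * n + 1 :=
    Primrec.succ.comp (Primrec.nat_mul.comp (Primrec.const 2) Primrec.id)
  have h2 : Nat.RecursiveIn {chi (join A B)} fun n : ℕ => Part.some (2 * n + 1) :=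
    Nat.RecursiveIn.of_eq h1.computableIn fun n => by simp
  refine ((Nat.RecursiveIn.oracle (chi (join A B)) (Set.mem_singleton _)).comp h2).of_eq fun n => ?_
  refine (Part.bind_some (2 * n + 1) (chi (join A B))).trans ?_
  by_cases h : n ∈ B
  · rw [chi_apply_of_mem h, chi_apply_of_mem (mul_two_add_one_mem_join.2 h)]
  · rw [chi_apply_of_notMem h, chi_apply_of_notMem (mt mul_two_add_one_mem_join.1 h)]

variable {M : Set (Set ℕ)}

/-- A function that is computable from the members of a Turing ideal is computable from one of
them. -/
theorem IsTuringIdeal.exists_recursiveIn (hM : IsTuringIdeal M) {f : ℕ →. ℕ}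
    (hf : Nat.RecursiveIn (chi '' M) f) : ∃ D ∈ M, Nat.RecursiveIn {chi D} f := by
  have common : ∀ {f h : ℕ →. ℕ}, (∃ D ∈ M, Nat.RecursiveIn {chi D} f) →
      (∃ D ∈ M, Nat.RecursiveIn {chi D} h) →
      ∃ D ∈ M, Nat.RecursiveIn {chi D} f ∧ Nat.RecursiveIn {chi D} h := by
    rintro f h ⟨A, hA, hf⟩ ⟨B, hB, hh⟩
    refine ⟨join A B, hM.join_mem A hA B hB, hf.subst ?_, hh.subst ?_⟩
    · rintro g rfl; exact recursiveIn_chi_left A B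
    · rintro g rfl; exact recursiveIn_chi_right A B
  obtain ⟨D₀, hD₀⟩ := hM.nonempty
  induction hf with
  | zero => exact ⟨D₀, hD₀, .zero⟩
  | succ => exact ⟨D₀, hD₀, .succ⟩
  | left => exact ⟨D₀, hD₀, .left⟩
  | right => exact ⟨D₀, hD₀, .right⟩
  | oracle g hg =>
    obtain ⟨D, hD, rfl⟩ := hg
    exact ⟨D, hD, .oracle _ rfl⟩
  | pair _ _ ih₁ ih₂ =>
    obtain ⟨D, hD, h₁, h₂⟩ := common ih₁ ih₂
    exact ⟨D, hD, h₁.pair h₂⟩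
  | comp _ _ ih₁ ih₂ =>
    obtain ⟨D, hD, h₁, h₂⟩ := common ih₁ ih₂
    exact ⟨D, hD, h₁.comp h₂⟩
  | prec _ _ ih₁ ih₂ =>
    obtain ⟨D, hD, h₁, h₂⟩ := common ih₁ ih₂
    exact ⟨D, hD, h₁.prec h₂⟩
  | rfind _ ih =>
    obtain ⟨D, hD, h⟩ := ih
    exact ⟨D, hD, h.rfind⟩

open Classical in
theorem computableIn_mem {D : Set ℕ} (hD : D ∈ M) :
    ComputableIn (chi '' M) fun n => decide (n ∈ D) := by
  have h1 : ComputableIn (chi '' M) fun n => if n ∈ D then 1 else 0 :=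
    RecursiveIn.oracle (chi D) ⟨D, hD, rfl⟩
  refine RecursiveIn.of_eq
    (computableIn_primrec_comp (f := fun n : ℕ => decide (n = 1)) ?_ h1) fun n => ?_
  · exact (Primrec.eq.comp Primrec.id (Primrec.const 1)).decide
  · by_cases h : n ∈ D <;> simp [h]

open Classical in
/-- A set of finite objects that is decidable relative to a Turing ideal belongs to it. -/
theorem IsTuringIdeal.setCode_mem (hM : IsTuringIdeal M) {α : Type} [Primcodable α] [Inhabited α]
    {T : Set α} (hT : ComputableIn (chi '' M) fun a => decide (a ∈ T)) : setCode T ∈ M := by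
  have hdec : Primrec fun n : ℕ => (decode (α := α) n).getD default :=
    Primrec.option_getD.comp Primrec.decode (Primrec.const default)
  have h1 : ComputableIn (chi '' M) fun n : ℕ =>
      (n, encode ((decode (α := α) n).getD default),
        decide ((decode (α := α) n).getD default ∈ T)) :=
    computableIn_pair (ComputableIn.id) (computableIn_pair (Primrec.encode.comp hdec).computableIn
      (computableIn_comp hT hdec.computableIn))
  -- The first equation rejects numbers that code no object: these decode to `default`, whose code
  -- is a different number.
  have h2 : Primrec fun q : ℕ × ℕ × Bool => if q.1 = q.2.1 ∧ q.2.2 = true then 1 else 0 :=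
    Primrec.ite ((Primrec.eq.comp Primrec.fst (Primrec.fst.comp Primrec.snd)).and
      (Primrec.eq.comp (Primrec.snd.comp Primrec.snd) (Primrec.const true)))
      (Primrec.const 1) (Primrec.const 0)
  have h3 := computableIn_primrec_comp h2 h1
  have h4 : Nat.RecursiveIn (chi '' M) (chi (setCode T)) := by
    refine Nat.RecursiveIn.of_eq h3 fun n => ?_
    simp only [chi, setCode, Set.mem_ofPred_eq, decode_nat, Part.coe_some, Part.bind_some,
      decide_eq_true_eq, Part.map_some, encode_nat]
    congr 2
    refine propext ⟨fun h => ⟨_, h.2, h.1⟩, ?_⟩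
    rintro ⟨a, ha, rfl⟩
    simpa using ha
  obtain ⟨D, hD, h5⟩ := hM.exists_recursiveIn h4
  exact hM.mem_of_computableFrom D hD _ (RecursiveIn.iff_nat.2 h5)

/-- A function whose graph belongs to the ideal is computable relative to the ideal. -/
theorem computableIn_of_graphCode_mem {α : Type} [Primcodable α] [Inhabited α] {F : ℕ → α}
    (hF : graphCode F ∈ M) : ComputableIn (chi '' M) F := by
  classical
  have h1 : ComputableIn₂ (chi '' M) fun n m => decide (Nat.pair n m ∈ graphCode F) :=
    computableIn_comp (computableIn_mem hF)
      (Primrec₂.natPair.comp Primrec.fst Primrec.snd).computableIn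
  have hmem : ∀ n m, Nat.pair n m ∈ graphCode F ↔ m = encode (F n) := by
    intro n m
    constructor
    · rintro ⟨k, hk⟩
      obtain ⟨rfl, rfl⟩ := Nat.pair_eq_pair.1 hk
      rfl
    · rintro rfl
      exact ⟨n, rfl⟩
  have h2 := computableIn_comp h1 (Primrec.pair (Primrec.fst (α := ℕ) (β := α))
    (Primrec.encode.comp Primrec.snd)).computableIn
  obtain ⟨G, hG, hGF⟩ := exists_computableIn_search
    (u := fun n a => decide (Nat.pair n (encode a) ∈ graphCode F)) h2
    fun n => ⟨F n, by simp [hmem]⟩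
  obtain rfl : G = F := funext fun n => by simpa [hmem] using hGF n
  exact hG

theorem IsTuringIdeal.left_mem (hM : IsTuringIdeal M) {A B : Set ℕ} (h : join A B ∈ M) : A ∈ M :=
  hM.mem_of_computableFrom _ h _ (RecursiveIn.iff_nat.2 (recursiveIn_chi_left A B))

theorem IsTuringIdeal.right_mem (hM : IsTuringIdeal M) {A B : Set ℕ} (h : join A B ∈ M) : B ∈ M :=
  hM.mem_of_computableFrom _ h _ (RecursiveIn.iff_nat.2 (recursiveIn_chi_right A B))

/-- An array that is computable relative to a Turing ideal is computable relative to one of its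
members. -/
theorem IsTuringIdeal.exists_computableArray (hM : IsTuringIdeal M) {k : ℕ}
    {L : ℕ → Fin k → List ℕ} (hL : ComputableIn₂ (chi '' M) L) :
    ∃ D ∈ M, ComputableArray D fun n j => (L n j).toFinset := by
  obtain ⟨D, hD, h⟩ := hM.exists_recursiveIn hL
  exact ⟨D, hD, L, h, fun _ _ => rfl⟩

end Ideal

/-! ### Approximating functionals on finite oracle strings -/

section Functional

open Filter

theorem primrecRel_forall_lt {β : Type*} [Primcodable β] {R : ℕ → β → Prop} (hR : PrimrecRel R) :
    PrimrecRel fun n y => ∀ x < n, R x y :=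
  (hR.forall_mem_list.comp (Primrec.list_range.comp Primrec.fst) Primrec.snd).of_eq (by simp)

theorem primrecRel_exists_lt {β : Type*} [Primcodable β] {R : ℕ → β → Prop} (hR : PrimrecRel R) :
    PrimrecRel fun n y => ∃ x < n, R x y :=
  (hR.exists_mem_list.comp (Primrec.list_range.comp Primrec.fst) Primrec.snd).of_eq (by simp)

open Classical in
/-- The initial segment of length `k` of a set of natural numbers. -/
noncomputable def oracleSeg (B : Set ℕ) (k : ℕ) : List Bool :=
  (List.range k).map fun i => decide (i ∈ B)

@[simp]
theorem length_oracleSeg (B : Set ℕ) (k : ℕ) : (oracleSeg B k).length = k := by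
  simp [oracleSeg]

open Classical in
theorem getElem?_oracleSeg {B : Set ℕ} {k i : ℕ} (h : i < k) :
    (oracleSeg B k)[i]? = some (decide (i ∈ B)) := by
  simp [oracleSeg, h]

/-- The set enumerated by the finite approximations to a functional. -/
def outputs (Φ : List Bool → ℕ → Option ℕ) (B : Set ℕ) : Set ℕ :=
  {m | ∃ k, Φ (oracleSeg B k) m = some 1}

/-- A partial function that is recursive in `B` is the limit of a primitive recursive function of
the initial segments of `B`. -/
theorem exists_approximation {B : Set ℕ} {f : ℕ →. ℕ} (hf : Nat.RecursiveIn {chi B} f) :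
    ∃ Φ : List Bool → ℕ → Option ℕ, Primrec₂ Φ ∧
      (∀ k x y, Φ (oracleSeg B k) x = some y → y ∈ f x) ∧
      ∀ x y, y ∈ f x → ∀ᶠ k in atTop, Φ (oracleSeg B k) x = some y := by
  induction hf with
  | zero =>
    refine ⟨fun _ _ => some 0, Primrec₂.const _, fun k x y h => ?_, fun x y h => ?_⟩
    · obtain rfl : 0 = y := by simpa using h
      exact Part.mem_some _
    · obtain rfl : y = 0 := Part.mem_some_iff.1 h
      simp
  | succ =>
    refine ⟨fun _ x => some (x + 1), ?_, fun k x y h => ?_, fun x y h => ?_⟩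
    · exact Primrec.option_some.comp (Primrec.succ.comp Primrec.snd)
    · obtain rfl : x + 1 = y := by simpa using h
      exact Part.mem_some _
    · obtain rfl : y = x + 1 := Part.mem_some_iff.1 h
      simp
  | left =>
    refine ⟨fun _ x => some x.unpair.1, ?_, fun k x y h => ?_, fun x y h => ?_⟩
    · exact Primrec.option_some.comp (Primrec.fst.comp (Primrec.unpair.comp Primrec.snd))
    · obtain rfl : x.unpair.1 = y := by simpa using h
      exact Part.mem_some _
    · obtain rfl : y = x.unpair.1 := Part.mem_some_iff.1 h
      simp
  | right =>
    refine ⟨fun _ x => some x.unpair.2, ?_, fun k x y h => ?_, fun x y h => ?_⟩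
    · exact Primrec.option_some.comp (Primrec.snd.comp (Primrec.unpair.comp Primrec.snd))
    · obtain rfl : x.unpair.2 = y := by simpa using h
      exact Part.mem_some _
    · obtain rfl : y = x.unpair.2 := Part.mem_some_iff.1 h
      simp
  | oracle g hg =>
    obtain rfl : g = chi B := hg
    refine ⟨fun τ x => τ[x]?.map fun b => cond b 1 0, ?_, fun k x y h => ?_, fun x y h => ?_⟩
    · exact Primrec.option_map (Primrec.list_getElem?.comp Primrec.fst Primrec.snd)
        ((Primrec.dom_finite fun b : Bool => cond b 1 0).comp Primrec.snd).to₂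
    · change (oracleSeg B k)[x]?.map _ = _ at h
      by_cases hx : x < k
      · rw [getElem?_oracleSeg hx] at h
        by_cases hB : x ∈ B
        · obtain rfl : 1 = y := by simpa [hB] using h
          simp [chi, hB]
        · obtain rfl : 0 = y := by simpa [hB] using h
          simp [chi, hB]
      · rw [List.getElem?_eq_none (by simpa [length_oracleSeg] using hx)] at h
        simp at h
    · filter_upwards [eventually_gt_atTop x] with k hk
      rw [getElem?_oracleSeg hk]
      by_cases hB : x ∈ B
      · obtain rfl : y = 1 := by simpa [chi, hB] using h
        simp [hB]
      · obtain rfl : y = 0 := by simpa [chi, hB] using h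
        simp [hB]
  | @pair f h _ _ ih₁ ih₂ =>
    obtain ⟨Φ, hΦ, s₁, c₁⟩ := ih₁
    obtain ⟨Ψ, hΨ, s₂, c₂⟩ := ih₂
    refine ⟨fun τ x => (Φ τ x).bind fun a => (Ψ τ x).map fun b => Nat.pair a b, ?_,
      fun k x y hy => ?_, fun x y hy => ?_⟩
    · refine Primrec.option_bind hΦ ?_
      refine Primrec.option_map (hΨ.comp (Primrec.fst.comp Primrec.fst)
        (Primrec.snd.comp Primrec.fst)) ?_
      exact Primrec₂.natPair.comp (Primrec.snd.comp Primrec.fst) Primrec.snd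
    · simp only [Option.bind_eq_some_iff, Option.map_eq_some_iff] at hy
      obtain ⟨a, ha, b, hb, rfl⟩ := hy
      have h1 := s₁ _ _ _ ha
      have h2 := s₂ _ _ _ hb
      simp only [Seq.seq, Part.map_eq_map, Part.mem_bind_iff, Part.mem_map_iff]
      exact ⟨_, ⟨a, h1, rfl⟩, b, h2, rfl⟩
    · simp only [Seq.seq, Part.map_eq_map, Part.mem_bind_iff, Part.mem_map_iff] at hy
      obtain ⟨_, ⟨a, ha, rfl⟩, b, hb, rfl⟩ := hy
      filter_upwards [c₁ _ _ ha, c₂ _ _ hb] with k h1 h2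
      simp [h1, h2]
  | @comp f h _ _ ih₁ ih₂ =>
    obtain ⟨Φ, hΦ, s₁, c₁⟩ := ih₁
    obtain ⟨Ψ, hΨ, s₂, c₂⟩ := ih₂
    refine ⟨fun τ x => (Ψ τ x).bind fun a => Φ τ a, ?_, fun k x y hy => ?_, fun x y hy => ?_⟩
    · exact Primrec.option_bind hΨ (hΦ.comp (Primrec.fst.comp Primrec.fst) Primrec.snd)
    · simp only [Option.bind_eq_some_iff] at hy
      obtain ⟨a, ha, hy⟩ := hy
      exact Part.mem_bind (s₂ _ _ _ ha) (s₁ _ _ _ hy)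
    · obtain ⟨a, ha, hy⟩ := Part.mem_bind_iff.1 hy
      filter_upwards [c₂ _ _ ha, c₁ _ _ hy] with k h1 h2
      simp [h1, h2]
  | @prec f h _ _ ih₁ ih₂ =>
    obtain ⟨Φ, hΦ, s₁, c₁⟩ := ih₁
    obtain ⟨Ψ, hΨ, s₂, c₂⟩ := ih₂
    refine ⟨fun τ x => Nat.rec (motive := fun _ => Option ℕ) (Φ τ x.unpair.1)
      (fun y IH => IH.bind fun i => Ψ τ (Nat.pair x.unpair.1 (Nat.pair y i))) x.unpair.2, ?_,
      fun k x => ?_, fun x => ?_⟩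
    · have hu1 : Primrec fun q : List Bool × ℕ => q.2.unpair.1 :=
        Primrec.fst.comp (Primrec.unpair.comp Primrec.snd)
      have hu2 : Primrec fun q : List Bool × ℕ => q.2.unpair.2 :=
        Primrec.snd.comp (Primrec.unpair.comp Primrec.snd)
      refine Primrec.nat_rec' (h := fun q p => p.2.bind fun i =>
        Ψ q.1 (Nat.pair q.2.unpair.1 (Nat.pair p.1 i))) hu2 (hΦ.comp Primrec.fst hu1) ?_
      refine Primrec.option_bind (Primrec.snd.comp Primrec.snd) ?_
      refine hΨ.comp (Primrec.fst.comp (Primrec.fst.comp Primrec.fst)) ?_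
      refine Primrec₂.natPair.comp (hu1.comp (Primrec.fst.comp Primrec.fst)) ?_
      exact Primrec₂.natPair.comp (Primrec.fst.comp (Primrec.snd.comp Primrec.fst)) Primrec.snd
    · simp only
      induction x.unpair.2 with
      | zero => exact fun y hy => s₁ _ _ _ hy
      | succ n ih =>
        intro y hy
        simp only [Option.bind_eq_some_iff] at hy
        obtain ⟨a, ha, hy⟩ := hy
        exact Part.mem_bind (ih _ ha) (s₂ _ _ _ hy)
    · simp only
      induction x.unpair.2 with
      | zero => exact fun y hy => c₁ _ _ hy
      | succ n ih =>
        intro y hy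
        obtain ⟨a, ha, hy⟩ := Part.mem_bind_iff.1 hy
        filter_upwards [ih _ ha, c₂ _ _ hy] with k h1 h2
        simp [h1, h2]
  | @rfind f _ ih =>
    obtain ⟨Φ, hΦ, s, c⟩ := ih
    -- search below the length of the string, with `0` for an undefined value
    let good : ℕ → List Bool × ℕ → Prop := fun n q =>
      Φ q.1 (Nat.pair q.2 n) = some 0 ∧
        ∀ i < n, Φ q.1 (Nat.pair q.2 i) ≠ none ∧ Φ q.1 (Nat.pair q.2 i) ≠ some 0
    have hgood : PrimrecRel good := by
      have h0 : Primrec fun p : ℕ × (List Bool × ℕ) => Φ p.2.1 (Nat.pair p.2.2 p.1) :=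
        hΦ.comp (Primrec.fst.comp Primrec.snd)
          (Primrec₂.natPair.comp (Primrec.snd.comp Primrec.snd) Primrec.fst)
      refine PrimrecPred.and (Primrec.eq.comp h0 (Primrec.const _)) ?_
      exact PrimrecRel.comp (primrecRel_forall_lt
        (R := fun (i : ℕ) (q : List Bool × ℕ) =>
          Φ q.1 (Nat.pair q.2 i) ≠ none ∧ Φ q.1 (Nat.pair q.2 i) ≠ some 0)
        (((Primrec.eq.comp h0 (Primrec.const _)).not).and
          ((Primrec.eq.comp h0 (Primrec.const _)).not))) Primrec.fst Primrec.snd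
    classical
    -- By uniqueness, the first good candidate found below the length of the string is the right
    -- value once the string is long enough.
    have huniq : ∀ {q n n'}, good n q → good n' q → n = n' := by
      intro q n n' h h'
      rcases lt_trichotomy n n' with hlt | rfl | hlt
      · exact absurd h.1 (h'.2 _ hlt).2
      · rfl
      · exact absurd h'.1 (h.2 _ hlt).2
    refine ⟨fun τ x => ((List.range τ.length).filter fun n => good n (τ, x)).head?, ?_,
      fun k x y hy => ?_, fun x y hy => ?_⟩
    · exact Primrec.list_head?.comp (hgood.listFilter.comp
        (Primrec.list_range.comp (Primrec.list_length.comp Primrec.fst)) Primrec.id)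
    · have hy' : good y (oracleSeg B k, x) := by
        have := List.mem_of_head? hy
        simpa using (List.mem_filter.1 this).2
      refine Nat.mem_rfind.2 ⟨?_, fun {m} hm => ?_⟩
      · simpa using s _ _ _ hy'.1
      · obtain ⟨h1, h2⟩ := hy'.2 _ hm
        obtain ⟨a, ha⟩ := Option.ne_none_iff_exists'.1 h1
        simp only [Part.map_eq_map, Part.mem_map_iff]
        refine ⟨a, s _ _ _ ha, ?_⟩
        rw [ha] at h2
        simpa using h2
    · obtain ⟨h1, h2⟩ := Nat.mem_rfind.1 hy
      have h1' : 0 ∈ f (Nat.pair x y) := by simpa using h1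
      have h2' : ∀ i < y, ∃ a ∈ f (Nat.pair x i), a ≠ 0 := by
        intro i hi
        have := h2 hi
        simpa using this
      choose! v hv hv0 using h2'
      have hall : ∀ᶠ k in atTop, ∀ i ∈ Finset.range y,
          Φ (oracleSeg B k) (Nat.pair x i) = some (v i) :=
        (Finset.eventually_all _).2 fun i hi => c _ _ (hv i (Finset.mem_range.1 hi))
      filter_upwards [c _ _ h1', hall, eventually_gt_atTop y] with k hk0 hk hky
      have hgy : good y (oracleSeg B k, x) := by
        refine ⟨hk0, fun i hi => ?_⟩
        have := hk i (Finset.mem_range.2 hi)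
        simp [this, hv0 i hi]
      have hmem : y ∈ (List.range (oracleSeg B k).length).filter
          fun n => good n (oracleSeg B k, x) := by
        simp [hgy, hky]
      obtain ⟨z, hz⟩ := Option.ne_none_iff_exists'.1
        (mt List.head?_eq_none_iff.1 (List.ne_nil_of_mem hmem))
      have hzg : good z (oracleSeg B k, x) := by
        simpa using (List.mem_filter.1 (List.mem_of_head? hz)).2
      rw [hz, huniq hzg hgy]

/-- Only enumerations are diagonalized against: soundness of the approximations excludes false
outputs, and their convergence supplies every element of the set. -/
theorem exists_outputs_eq {H B : Set ℕ} (h : ComputableFrom H B) :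
    ∃ Φ : List Bool → ℕ → Option ℕ, Primrec₂ Φ ∧ outputs Φ B = H := by
  obtain ⟨Φ, hΦ, hs, hc⟩ := exists_approximation (RecursiveIn.iff_nat.1 h)
  refine ⟨Φ, hΦ, Set.ext fun m => ⟨?_, fun hm => ?_⟩⟩
  · rintro ⟨k, hk⟩
    by_contra hm
    have := hs _ _ _ hk
    simp [chi, hm] at this
  · exact (hc m 1 (by simp [chi, hm])).exists

/-- A code for a functional determines it. Countability leaves only countably many requirements to
meet. -/
theorem countable_primrec₂ : {Φ : List Bool → ℕ → Option ℕ | Primrec₂ Φ}.Countable := by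
  have h : ∀ Φ : {Φ : List Bool → ℕ → Option ℕ // Primrec₂ Φ}, ∃ c : Nat.Partrec.Code,
      c.eval = fun n => Part.bind (decode (α := List Bool × ℕ) n) fun a : List Bool × ℕ =>
        (Part.some (Φ.1 a.1 a.2)).map encode := fun Φ =>
    Nat.Partrec.Code.exists_code.1 (Primrec.to_comp Φ.2)
  choose c hc using h
  refine Set.countable_coe_iff.1 (Function.Injective.countable (f := c) fun Φ Ψ he => ?_)
  have := (hc Φ).symm.trans (he ▸ hc Ψ)
  refine Subtype.ext (funext fun τ => funext fun x => ?_)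
  have := congrFun this (encode (τ, x))
  simpa using this

end Functional

open Filter

/-! ### Quantifiers over finite types -/

section Finite

variable {α : Type*} [Primcodable α]

theorem primrecPred_forall_finite {ι : Type*} [Finite ι] {R : ι → α → Prop}
    (hR : ∀ i, PrimrecPred (R i)) : PrimrecPred fun a => ∀ i, R i a := by
  have key : ∀ l : List ι, PrimrecPred fun a => ∀ i ∈ l, R i a := by
    intro l
    induction l with
    | nil => exact (Primrec.eq.comp (Primrec.const 0) (Primrec.const 0)).of_eq fun a => by simp
    | cons i l ih => exact ((hR i).and ih).of_eq fun a => by simp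
  have := Fintype.ofFinite ι
  exact (key Finset.univ.toList).of_eq fun a => by simp

theorem primrecPred_exists_finite {ι : Type*} [Finite ι] {R : ι → α → Prop}
    (hR : ∀ i, PrimrecPred (R i)) : PrimrecPred fun a => ∃ i, R i a :=
  (primrecPred_forall_finite fun i => (hR i).not).not.of_eq fun a => by simp

end Finite

/-! ### Strings, and compactness for cross-trees -/

section Strings

/-- The list of all `r`-tuples of binary strings of length `n`. -/
noncomputable def stringTuples (r : ℕ) : ℕ → List (Fin r → List (Fin 2))
  | 0 => [fun _ => []]
  | n + 1 => (stringTuples r n).flatMap fun σ =>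
      (Finset.univ : Finset (Fin r → Fin 2)).toList.map fun b s => b s :: σ s

theorem primrec_stringTuples (r : ℕ) : Primrec (stringTuples r) := by
  refine (Primrec.nat_rec₁ (f := fun _ (l : List (Fin r → List (Fin 2))) => l.flatMap fun σ =>
      (Finset.univ : Finset (Fin r → Fin 2)).toList.map fun b s => b s :: σ s)
    [fun _ => []] ?_).of_eq fun n => ?_
  · refine Primrec.list_flatMap Primrec.snd (Primrec.list_map (Primrec.const _) ?_)
    refine Primrec.fin_curry.2 ?_
    exact Primrec.list_cons.comp
      (Primrec.fin_app.comp (Primrec.snd.comp Primrec.fst) Primrec.snd)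
      (Primrec.fin_app.comp (Primrec.snd.comp (Primrec.fst.comp Primrec.fst)) Primrec.snd)
  · induction n with
    | zero => rfl
    | succ n ih => simp only [stringTuples, ih]

theorem mem_stringTuples {r n : ℕ} {σ : Fin r → List (Fin 2)} :
    σ ∈ stringTuples r n ↔ ∀ s, (σ s).length = n := by
  induction n generalizing σ with
  | zero =>
    simp only [stringTuples, List.mem_singleton, List.length_eq_zero_iff]
    exact funext_iff
  | succ n ih =>
    simp only [stringTuples, List.mem_flatMap, List.mem_map, Finset.mem_toList, Finset.mem_univ,
      true_and, ih]
    constructor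
    · rintro ⟨τ, hτ, b, rfl⟩ s
      simp [hτ]
    · intro h
      have hne : ∀ s, σ s ≠ [] := fun s hs => by simpa [hs] using h s
      exact ⟨fun s => (σ s).tail, fun s => by simp [h], fun s => (σ s).head (hne s),
        funext fun s => List.cons_head_tail (hne s)⟩

theorem length_initSeg {k : ℕ} (X : ℕ → Fin k) (n : ℕ) : (initSeg X n).length = n := by
  simp [initSeg]

theorem getElem?_initSeg {k : ℕ} (X : ℕ → Fin k) {n m : ℕ} (h : m < n) :
    (initSeg X n)[m]? = some (X m) := by
  simp [initSeg, h]

theorem initSeg_prefix {k : ℕ} (X : ℕ → Fin k) {m n : ℕ} (h : m ≤ n) :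
    initSeg X m <+: initSeg X n := by
  obtain ⟨d, rfl⟩ := Nat.exists_eq_add_of_le h
  simp [initSeg, List.range_add]

theorem getElem?_of_prefix {α : Type*} {l l' : List α} (h : l <+: l') {i : ℕ} {a : α}
    (ha : l[i]? = some a) : l'[i]? = some a := by
  obtain ⟨t, rfl⟩ := h
  rw [List.getElem?_append_left, ha]
  exact (List.getElem?_eq_some_iff.1 ha).1

/-- A cross-tree is left-full when every left string has a companion of the same length. -/
theorem leftFull_of_forall_exists {r : ℕ} {T : Set (Node r)} (hT : IsCrossTree T)
    (h : ∀ ρ : List (Fin 3), ∃ σ ∈ stringTuples r ρ.length, ((ρ, σ) : Node r) ∈ T) :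
    LeftFull T := by
  intro X
  -- A companion of `X` is a point in the intersection of these decreasing, nonempty closed subsets
  -- of a compact space.
  let C : ℕ → Set (Fin r → ℕ → Fin 2) := fun n =>
    {Y | ((initSeg X n, fun s => initSeg (Y s) n) : Node r) ∈ T}
  have hclosed : ∀ n, IsClosed (C n) := by
    intro n
    have hcont : Continuous fun (Y : Fin r → ℕ → Fin 2) (s : Fin r) (i : Fin n) => Y s i := by
      fun_prop
    have : C n = (fun (Y : Fin r → ℕ → Fin 2) (s : Fin r) (i : Fin n) => Y s i) ⁻¹'
        {z | ((initSeg X n, fun s => List.ofFn (z s)) : Node r) ∈ T} := by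
      ext Y
      have : ∀ s, initSeg (Y s) n = List.ofFn fun i : Fin n => Y s i := fun s =>
        List.ext_getElem (by simp [initSeg]) fun i h₁ h₂ => by simp [initSeg]
      simp [C, this]
    rw [this]
    exact (isClosed_discrete _).preimage hcont
  have hne : (⋂ n, C n).Nonempty := by
    refine IsCompact.nonempty_iInter_of_sequence_nonempty_isCompact_isClosed C (fun n Y hY => ?_)
      (fun n => ?_) (hclosed 0).isCompact hclosed
    · refine hT.prefix_mem _ hY _ ⟨fun i j => by simp [length_initSeg], fun i => by
        simp [length_initSeg]⟩ ⟨initSeg_prefix X n.le_succ, fun s => initSeg_prefix _ n.le_succ⟩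
    · obtain ⟨σ, hσ, hmem⟩ := h (initSeg X n)
      rw [length_initSeg, mem_stringTuples] at hσ
      refine ⟨fun s i => (σ s).getD i 0, ?_⟩
      have : ∀ s, initSeg (fun i => (σ s).getD i 0) n = σ s := fun s =>
        List.ext_getElem (by simp [initSeg, hσ]) fun i h₁ h₂ => by simp [initSeg, h₂]
      change ((initSeg X n, fun s => initSeg (fun i => (σ s).getD i 0) n) : Node r) ∈ T
      simpa only [this] using hmem
  obtain ⟨Y, hY⟩ := hne
  exact ⟨Y, fun n => Set.mem_iInter.1 hY n⟩

end Strings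

/-! ### The cross-tree of nodes without witnesses -/

/-- The position of the statement that `x` belongs to the `s`-th set, in the join of a set with
the join of a tuple of sets. -/
def position {r : ℕ} (s : Fin r) (x : ℕ) : ℕ := 2 * Nat.pair s x + 1

theorem le_position {r : ℕ} (s : Fin r) (x : ℕ) : x < position s x := by
  have := Nat.right_le_pair s x
  simp only [position]
  omega

/-- Finitely many functionals `Φ k`, with colors `j k` and oracles `lower k`, each for one of the
tuples `γ k` of colors, together with enumerations of reservoirs. -/
structure Task (r K : ℕ) where
  reservoir : ℕ → Fin r → ℕ
  γ : Fin K → Fin r → Fin 2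
  Φ : Fin K → List Bool → ℕ → Option ℕ
  j : Fin K → Fin 3
  lower : Fin K → Set ℕ

namespace Task

variable {r K : ℕ} (S : Task r K)

/-- The oracle string `τ` makes `Φ k` enumerate `m`, and `τ` is compatible with the part of the
reservoirs that has the colors `γ k` according to the right side of the node `χ`. -/
def Computes (k : Fin K) (N : ℕ) (χ : Node r) (τ : List Bool) (m : ℕ) : Prop :=
  τ.length ≤ χ.1.length ∧ N < m ∧ χ.1[m]? ≠ none ∧ χ.1[m]? ≠ some (S.j k) ∧
    S.Φ k τ m = some 1 ∧ ∀ i < τ.length, (i ∈ S.lower k → τ[i]? = some true) ∧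
      (τ[i]? = some true → i ∈ S.lower k ∨
        ∃ n < χ.1.length, ∃ s, (χ.2 s)[n]? = some (S.γ k s) ∧ position s (S.reservoir n s) = i)

/-- Some number above `N` that does not have the color `j k` on the left side of the node is
enumerated by `Φ k`. -/
def Witness (k : Fin K) (N : ℕ) (χ : Node r) : Prop :=
  ∃ w < χ.1.length, ∃ τ m, encode (τ, m) = w ∧ S.Computes k N χ τ m

/-- The cross-tree of the nodes without witnesses. -/
def tree (N : ℕ) : Set (Node r) := {χ | χ.Balanced ∧ ∀ k, ¬ S.Witness k N χ}

/-- Every companion of the string of its length has a witness. -/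
def Blocked (N : ℕ) (ρ : List (Fin 3)) : Prop :=
  ∀ σ ∈ stringTuples r ρ.length, ∃ k, S.Witness k N (ρ, σ)

variable {S} in
-- All bounds in a witness are bounds by the length of the left string, and all other data are
-- values already present in the strings, so both survive extension. This is what closes the tree
-- under prefixes.
theorem Witness.mono {k : Fin K} {N : ℕ} {χ ψ : Node r} (h : S.Witness k N χ)
    (hχ : χ.IsPrefix ψ) : S.Witness k N ψ := by
  have hlen := hχ.1.length_le
  obtain ⟨w, hw, τ, m, hτ, h1, h2, h3, h4, h5, h6⟩ := h
  obtain ⟨a, ha⟩ := Option.ne_none_iff_exists'.1 h3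
  have ha' := getElem?_of_prefix hχ.1 ha
  refine ⟨w, hw.trans_le hlen, τ, m, hτ, h1.trans hlen, h2, by simp [ha'], ?_, h5,
    fun i hi => ⟨(h6 i hi).1, fun hτi => ?_⟩⟩
  · rw [ha']
    rwa [ha] at h4
  · rcases (h6 i hi).2 hτi with h | ⟨n, hn, s, hs, he⟩
    · exact Or.inl h
    · exact Or.inr ⟨n, hn.trans_le hlen, s, getElem?_of_prefix (hχ.2 s) hs, he⟩

theorem isCrossTree_tree (N : ℕ) : IsCrossTree (S.tree N) where
  balanced _ h := h.1
  prefix_mem _ h _ hb hp := ⟨hb, fun k hk => h.2 k (hk.mono hp)⟩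

/-- If no string is blocked, every left string has a companion of its own length in the tree, and
compactness applies. -/
theorem leftFull_or_blocked (N : ℕ) : LeftFull (S.tree N) ∨ ∃ ρ, S.Blocked N ρ := by
  by_cases h : ∃ ρ, S.Blocked N ρ
  · exact Or.inr h
  · refine Or.inl (leftFull_of_forall_exists (S.isCrossTree_tree N) fun ρ => ?_)
    simp only [Blocked, not_exists, not_forall] at h
    obtain ⟨σ, hσ, hk⟩ := h ρ
    have hl := mem_stringTuples.1 hσ
    exact ⟨σ, hσ, ⟨fun i j => by simp [hl], fun i => by simp [hl]⟩, hk⟩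

/-! ### Decidability -/

open Classical in
/-- The information on the oracles and the reservoirs below `n`. -/
noncomputable def table (n : ℕ) : List ((Fin K → Bool) × (Fin r → ℕ)) :=
  (List.range n).map fun i =>
    (fun k => decide (i ∈ S.lower k), fun s => position s (S.reservoir i s))

/-- `Computes`, in terms of a table. -/
def ComputesTable (k : Fin K) (t : List Bool × ℕ)
    (x : List ((Fin K → Bool) × (Fin r → ℕ)) × ℕ × Node r) : Prop :=
  t.1.length ≤ x.2.2.1.length ∧ x.2.1 < t.2 ∧ x.2.2.1[t.2]? ≠ none ∧
    x.2.2.1[t.2]? ≠ some (S.j k) ∧ S.Φ k t.1 t.2 = some 1 ∧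
    ∀ i < t.1.length, (x.1[i]?.map (fun e => e.1 k) = some true → t.1[i]? = some true) ∧
      (t.1[i]? = some true → x.1[i]?.map (fun e => e.1 k) = some true ∨
        ∃ n < x.2.2.1.length, ∃ s, (x.2.2.2 s)[n]? = some (S.γ k s) ∧
          x.1[n]?.map (fun e => e.2 s) = some i)

theorem computesTable_iff {k : Fin K} {N : ℕ} {χ : Node r} {τ : List Bool} {m : ℕ} :
    S.ComputesTable k (τ, m) (S.table χ.1.length, N, χ) ↔ S.Computes k N χ τ m := by
  unfold ComputesTable Computes
  refine and_congr_right fun h1 => and_congr_right fun _ => and_congr_right fun _ =>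
    and_congr_right fun _ => and_congr_right fun _ => forall_congr' fun i =>
    forall_congr' fun hi => ?_
  have hi' : i < χ.1.length := lt_of_lt_of_le hi h1
  have h2 : (S.table χ.1.length)[i]?.map (fun e => e.1 k) = some true ↔ i ∈ S.lower k := by
    simp [table, hi']
  have h3 : ∀ n < χ.1.length, ∀ s, (S.table χ.1.length)[n]?.map (fun e => e.2 s) = some i ↔
      position s (S.reservoir n s) = i := by
    intro n hn s
    simp [table, hn]
  simp only [h2]
  refine and_congr_right fun _ => imp_congr_right fun _ => or_congr_right ?_
  exact exists_congr fun n => and_congr_right fun hn => exists_congr fun s =>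
    and_congr_right fun _ => h3 n hn s

variable {S} (hΦ : ∀ k, Primrec₂ (S.Φ k))
include hΦ

theorem primrecRel_computesTable (k : Fin K) : PrimrecRel (S.ComputesTable k) := by
  have hτ : Primrec fun p : (List Bool × ℕ) × (List ((Fin K → Bool) × (Fin r → ℕ)) × ℕ × Node r) =>
      p.1.1 := Primrec.fst.comp Primrec.fst
  have hm : Primrec fun p : (List Bool × ℕ) × (List ((Fin K → Bool) × (Fin r → ℕ)) × ℕ × Node r) =>
      p.1.2 := Primrec.snd.comp Primrec.fst
  have hd : Primrec fun p : (List Bool × ℕ) × (List ((Fin K → Bool) × (Fin r → ℕ)) × ℕ × Node r) =>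
      p.2.1 := Primrec.fst.comp Primrec.snd
  have hN : Primrec fun p : (List Bool × ℕ) × (List ((Fin K → Bool) × (Fin r → ℕ)) × ℕ × Node r) =>
      p.2.2.1 := Primrec.fst.comp (Primrec.snd.comp Primrec.snd)
  have hρ : Primrec fun p : (List Bool × ℕ) × (List ((Fin K → Bool) × (Fin r → ℕ)) × ℕ × Node r) =>
      p.2.2.2.1 := Primrec.fst.comp (Primrec.snd.comp (Primrec.snd.comp Primrec.snd))
  have hσ : Primrec fun p : (List Bool × ℕ) × (List ((Fin K → Bool) × (Fin r → ℕ)) × ℕ × Node r) =>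
      p.2.2.2.2 := Primrec.snd.comp (Primrec.snd.comp (Primrec.snd.comp Primrec.snd))
  have hlow : ∀ k, PrimrecRel fun (i : ℕ)
      (p : (List Bool × ℕ) × (List ((Fin K → Bool) × (Fin r → ℕ)) × ℕ × Node r)) =>
      p.2.1[i]?.map (fun e => e.1 k) = some true := fun k => by
    refine Primrec.eq.comp (Primrec.option_map
      (Primrec.list_getElem?.comp (hd.comp Primrec.snd) Primrec.fst) ?_) (Primrec.const _)
    exact Primrec.fin_app.comp (Primrec.fst.comp Primrec.snd) (Primrec.const k)
  have htau : PrimrecRel fun (i : ℕ)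
      (p : (List Bool × ℕ) × (List ((Fin K → Bool) × (Fin r → ℕ)) × ℕ × Node r)) =>
      p.1.1[i]? = some true :=
    Primrec.eq.comp (Primrec.list_getElem?.comp (hτ.comp Primrec.snd) Primrec.fst)
      (Primrec.const _)
  have hex : PrimrecRel fun (i : ℕ)
      (p : (List Bool × ℕ) × (List ((Fin K → Bool) × (Fin r → ℕ)) × ℕ × Node r)) =>
      ∃ n < p.2.2.2.1.length, ∃ s, (p.2.2.2.2 s)[n]? = some (S.γ k s) ∧
        p.2.1[n]?.map (fun e => e.2 s) = some i := by
    refine PrimrecRel.comp (primrecRel_exists_lt (R := fun (n : ℕ)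
      (q : ℕ × ((List Bool × ℕ) × (List ((Fin K → Bool) × (Fin r → ℕ)) × ℕ × Node r))) =>
      ∃ s, (q.2.2.2.2.2 s)[n]? = some (S.γ k s) ∧
        q.2.2.1[n]?.map (fun e => e.2 s) = some q.1) ?_)
      (Primrec.list_length.comp (hρ.comp Primrec.snd)) Primrec.id
    refine primrecPred_exists_finite fun s => PrimrecPred.and ?_ ?_
    · exact Primrec.eq.comp (Primrec.list_getElem?.comp (Primrec.fin_app.comp
        (hσ.comp (Primrec.snd.comp Primrec.snd)) (Primrec.const s)) Primrec.fst) (Primrec.const _)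
    · refine Primrec.eq.comp (Primrec.option_map (Primrec.list_getElem?.comp
        (hd.comp (Primrec.snd.comp Primrec.snd)) Primrec.fst) ?_)
        (Primrec.option_some.comp (Primrec.fst.comp Primrec.snd))
      exact Primrec.fin_app.comp (Primrec.snd.comp Primrec.snd) (Primrec.const s)
  have hget := Primrec.list_getElem?.comp hρ hm
  refine PrimrecPred.and
    (Primrec.nat_le.comp (Primrec.list_length.comp hτ) (Primrec.list_length.comp hρ)) ?_
  refine PrimrecPred.and (Primrec.nat_lt.comp hN hm) ?_
  refine PrimrecPred.and (Primrec.eq.comp hget (Primrec.const _)).not ?_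
  refine PrimrecPred.and (Primrec.eq.comp hget (Primrec.const _)).not ?_
  refine PrimrecPred.and (Primrec.eq.comp ((hΦ k).comp hτ hm) (Primrec.const _)) ?_
  refine PrimrecRel.comp (primrecRel_forall_lt (R := fun (i : ℕ)
      (p : (List Bool × ℕ) × (List ((Fin K → Bool) × (Fin r → ℕ)) × ℕ × Node r)) =>
      (p.2.1[i]?.map (fun e => e.1 k) = some true → p.1.1[i]? = some true) ∧
      (p.1.1[i]? = some true → p.2.1[i]?.map (fun e => e.1 k) = some true ∨
        ∃ n < p.2.2.2.1.length, ∃ s, (p.2.2.2.2 s)[n]? = some (S.γ k s) ∧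
          p.2.1[n]?.map (fun e => e.2 s) = some i)) ?_)
    (Primrec.list_length.comp hτ) Primrec.id
  refine PrimrecPred.of_eq (PrimrecPred.and (PrimrecPred.or (PrimrecPred.not (hlow k)) htau)
    (PrimrecPred.or (PrimrecPred.not htau) (PrimrecPred.or (hlow k) hex))) fun q => ?_
  rw [← imp_iff_not_or, ← imp_iff_not_or]

/-- Bounding the code of the computation by the length of the left string makes the search finite,
and a table of that length holds everything the search consults. All dependence on the oracle is
thus confined to the table. -/
theorem exists_primrec_witness (k : Fin K) :
    ∃ R : List ((Fin K → Bool) × (Fin r → ℕ)) × ℕ × Node r → Prop, PrimrecPred R ∧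
      ∀ N χ, R (S.table χ.1.length, N, χ) ↔ S.Witness k N χ := by
  refine ⟨fun x => ∃ w < x.2.2.1.length,
    encode ((decode (α := List Bool × ℕ) w).getD default) = w ∧
      S.ComputesTable k ((decode (α := List Bool × ℕ) w).getD default) x, ?_, fun N χ => ?_⟩
  · have hdec : Primrec fun w : ℕ => (decode (α := List Bool × ℕ) w).getD default :=
      Primrec.option_getD.comp Primrec.decode (Primrec.const default)
    refine PrimrecRel.comp (primrecRel_exists_lt (R := fun (w : ℕ)
      (x : List ((Fin K → Bool) × (Fin r → ℕ)) × ℕ × Node r) =>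
      encode ((decode (α := List Bool × ℕ) w).getD default) = w ∧
      S.ComputesTable k ((decode (α := List Bool × ℕ) w).getD default) x) ?_)
      (Primrec.list_length.comp (Primrec.fst.comp (Primrec.snd.comp Primrec.snd))) Primrec.id
    exact PrimrecPred.and
      (Primrec.eq.comp (Primrec.encode.comp (hdec.comp Primrec.fst)) Primrec.fst)
      ((primrecRel_computesTable hΦ k).comp (hdec.comp Primrec.fst) Primrec.snd)
  · refine exists_congr fun w => and_congr_right fun _ => ⟨?_, ?_⟩
    · rintro ⟨h1, h2⟩
      exact ⟨_, _, h1, S.computesTable_iff.1 h2⟩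
    · rintro ⟨τ, m, rfl, h⟩
      simpa using S.computesTable_iff.2 h

variable {O : Set (ℕ →. ℕ)} (hres : ComputableIn O S.reservoir)

omit hΦ in
open Classical in
include hres in
theorem computableIn_table (hlow : ∀ k, ComputableIn O fun i => decide (i ∈ S.lower k)) :
    ComputableIn O S.table := by
  refine CrossConstraint.computableIn_table (computableIn_pair (computableIn_finArrow hlow) ?_)
  refine computableIn_primrec_comp (f := fun (v : Fin r → ℕ) s => position s (v s)) ?_ hres
  refine Primrec.fin_curry.2 (Primrec.succ.comp (Primrec.nat_mul.comp (Primrec.const 2)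
    (Primrec₂.natPair.comp (Primrec.fin_val.comp Primrec.snd) ?_)))
  exact Primrec.fin_app.comp Primrec.fst Primrec.snd

open Classical in
include hres in
theorem computableIn_tree (hlow : ∀ k, ComputableIn O fun i => decide (i ∈ S.lower k)) (N : ℕ) :
    ComputableIn O fun χ => decide (χ ∈ S.tree N) := by
  choose R hR hRW using exists_primrec_witness hΦ
  have hlen : Primrec fun χ : Node r => χ.1.length := Primrec.list_length.comp Primrec.fst
  have h1 : ComputableIn O fun χ : Node r => (S.table χ.1.length, N, χ) :=
    computableIn_pair (computableIn_comp (computableIn_table hres hlow) hlen.computableIn)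
      (computableIn_pair (ComputableIn.const N) ComputableIn.id)
  have hbal : PrimrecPred fun χ : Node r => χ.Balanced := by
    have hs : ∀ s, Primrec fun χ : Node r => (χ.2 s).length := fun s =>
      Primrec.list_length.comp (Primrec.fin_app.comp Primrec.snd (Primrec.const s))
    exact (primrecPred_forall_finite fun i => primrecPred_forall_finite fun j =>
      Primrec.eq.comp (hs i) (hs j)).and
        (primrecPred_forall_finite fun i => Primrec.nat_le.comp (hs i) hlen)
  have h2 : PrimrecPred fun x : List ((Fin K → Bool) × (Fin r → ℕ)) × ℕ × Node r =>
      x.2.2.Balanced ∧ ∀ k, ¬ R k x :=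
    (hbal.comp (Primrec.snd.comp Primrec.snd)).and
      (primrecPred_forall_finite fun k => (hR k).not)
  refine RecursiveIn.of_eq (computableIn_primrec_comp h2.decide h1) fun χ => ?_
  refine congrArg Part.some (decide_eq_decide.2 ?_)
  simp [tree, hRW]

open Classical in
include hres in
-- Only the finitely many companions of the same length are tested, so a blocked string can be
-- recognized and then searched for.
theorem computableIn_blocked (hlow : ∀ k, ComputableIn O fun i => decide (i ∈ S.lower k)) :
    ComputableIn₂ O fun N ρ => decide (S.Blocked N ρ) := by
  choose R hR hRW using exists_primrec_witness hΦ
  have h1 : ComputableIn O fun p : ℕ × List (Fin 3) => (S.table p.2.length, p) :=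
    computableIn_pair (computableIn_comp (computableIn_table hres hlow)
      (Primrec.list_length.comp Primrec.snd).computableIn) ComputableIn.id
  have h2 : PrimrecPred fun x : List ((Fin K → Bool) × (Fin r → ℕ)) × ℕ × List (Fin 3) =>
      ∀ σ ∈ stringTuples r x.2.2.length, ∃ k, R k (x.1, x.2.1, x.2.2, σ) := by
    refine PrimrecRel.comp (PrimrecRel.forall_mem_list (R := fun (σ : Fin r → List (Fin 2))
      (x : List ((Fin K → Bool) × (Fin r → ℕ)) × ℕ × List (Fin 3)) =>
      ∃ k, R k (x.1, x.2.1, x.2.2, σ)) ?_) ((primrec_stringTuples r).comp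
        (Primrec.list_length.comp (Primrec.snd.comp Primrec.snd))) Primrec.id
    refine primrecPred_exists_finite fun k => (hR k).comp ?_
    exact Primrec.pair (Primrec.fst.comp Primrec.snd)
      (Primrec.pair (Primrec.fst.comp (Primrec.snd.comp Primrec.snd))
        (Primrec.pair (Primrec.snd.comp (Primrec.snd.comp Primrec.snd)) Primrec.fst))
  refine RecursiveIn.of_eq (computableIn_primrec_comp h2.decide h1) fun p => ?_
  have : ∀ σ k, R k (S.table p.2.length, p.1, p.2, σ) ↔ S.Witness k p.1 (p.2, σ) :=
    fun σ k => hRW k p.1 (p.2, σ)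
  refine congrArg Part.some (decide_eq_decide.2 ?_)
  simp only [this, Blocked]

end Task

/-! ### The two cases: a left-full tree, or blocked strings for every bound -/

namespace Task

variable {r K : ℕ} {S : Task r K} {M : Set (Set ℕ)}

open Classical in
/-- If the tree of the nodes without witnesses is left-full, a solution to it thins out the
reservoirs so that one of the functionals has a finite output. -/
theorem exists_reservoir_of_leftFull (hM : IsCrossConstraintIdeal r M)
    (hΦ : ∀ k, Primrec₂ (S.Φ k)) (hres : ComputableIn (chi '' M) S.reservoir)
    (hlow : ∀ k, ComputableIn (chi '' M) fun i => decide (i ∈ S.lower k))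
    (htend : ∀ s, Tendsto (fun n => S.reservoir n s) atTop atTop)
    (hγ : Function.Surjective S.γ) {N : ℕ} (hfull : LeftFull (S.tree N)) :
    ∃ (k : Fin K) (q : ℕ → Fin r → ℕ), ComputableIn (chi '' M) q ∧
      (∀ s, Tendsto (fun n => q n s) atTop atTop) ∧ (∀ n s, ∃ i, q n s = S.reservoir i s) ∧
      ∀ B : Set ℕ, S.lower k ⊆ B →
        (∀ i ∈ B, i ∈ S.lower k ∨ ∃ s n, i = position s (q n s)) → (outputs (S.Φ k) B).Finite := by
  have hT : setCode (S.tree N) ∈ M :=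
    hM.isTuringIdeal.setCode_mem (computableIn_tree hΦ hres hlow N)
  obtain ⟨X, Y, hsol, hmem⟩ := hM.exists_solution _ ⟨S.isCrossTree_tree N, hfull⟩ hT
  have hY0 := computableIn_of_graphCode_mem (hM.isTuringIdeal.left_mem hmem)
  have hY1 := computableIn_of_graphCode_mem (hM.isTuringIdeal.right_mem hmem)
  have hcol : ∀ s, ∃ c, {x | Y 0 s x = c ∧ Y 1 s x = c}.Infinite := by
    intro s
    by_contra h
    exact hsol.right s fun c => Set.not_infinite.1 fun hc => h ⟨c, hc⟩
  choose a ha using hcol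
  -- The solution, not the construction, decides which tuple of colors is dealt with; hence the need
  -- for a functional at every tuple.
  obtain ⟨k, hk⟩ := hγ a
  have hex : ∀ s n, ∃ m, decide (n ≤ m ∧ Y 0 s m = a s ∧ Y 1 s m = a s) = true := by
    intro s n
    obtain ⟨m, hm, hnm⟩ := (ha s).exists_gt n
    exact ⟨m, by simpa using ⟨hnm.le, hm⟩⟩
  have hcomp : ∀ s, ComputableIn₂ (chi '' M) fun n m =>
      decide (n ≤ m ∧ Y 0 s m = a s ∧ Y 1 s m = a s) := by
    intro s
    have h1 := computableIn_pair (ComputableIn.id (α := ℕ × ℕ)) (computableIn_pair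
      (computableIn_comp hY0 (ComputableIn.snd (α := ℕ) (β := ℕ)))
      (computableIn_comp hY1 (ComputableIn.snd (α := ℕ) (β := ℕ))))
    have h2 : PrimrecPred fun x : (ℕ × ℕ) × (Fin 3 × (Fin r → Fin 2)) ×
        (Fin 3 × (Fin r → Fin 2)) => x.1.1 ≤ x.1.2 ∧ x.2.1.2 s = a s ∧ x.2.2.2 s = a s := by
      refine PrimrecPred.and (Primrec.nat_le.comp (Primrec.fst.comp Primrec.fst)
        (Primrec.snd.comp Primrec.fst)) (PrimrecPred.and
          (Primrec.eq.comp (Primrec.fin_app.comp ?_ (Primrec.const s)) (Primrec.const _))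
          (Primrec.eq.comp (Primrec.fin_app.comp ?_ (Primrec.const s)) (Primrec.const _)))
      · exact Primrec.snd.comp (Primrec.fst.comp Primrec.snd)
      · exact Primrec.snd.comp (Primrec.snd.comp Primrec.snd)
    refine RecursiveIn.of_eq (computableIn_primrec_comp h2.decide h1) fun x => ?_
    exact congrArg Part.some (decide_eq_decide.2 Iff.rfl)
  have hfind : ∀ s, ∃ q : ℕ → ℕ, ComputableIn (chi '' M) q ∧
      ∀ n, n ≤ q n ∧ Y 0 s (q n) = a s ∧ Y 1 s (q n) = a s := fun s =>
    ⟨_, computableIn_find (hcomp s) (hex s), fun n => by simpa using Nat.find_spec (hex s n)⟩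
  choose q hq hqs using hfind
  have hqtend : ∀ s, Tendsto (q s) atTop atTop := fun s =>
    tendsto_atTop_mono (fun n => (hqs s n).1) tendsto_id
  refine ⟨k, fun n s => S.reservoir (q s n) s, ?_, fun s => (htend s).comp (hqtend s),
    fun n s => ⟨_, rfl⟩, fun B hB hB' => ?_⟩
  · exact computableIn_finArrow fun s => computableIn_primrec_comp
      (f := fun v : Fin r → ℕ => v s) (Primrec.fin_app.comp Primrec.id (Primrec.const s))
      (computableIn_comp hres (hq s))
  -- Outputs above `N` lie where both left sides have the color `j k`, a finite set.
  · refine ((Set.finite_Iic N).union (hsol.left (S.j k))).subset fun m hm => ?_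
    by_cases hmN : m ≤ N
    · exact Or.inl hmN
    push Not at hmN
    obtain ⟨t, ht⟩ := hm
    have key : ∀ i, X i m = S.j k := by
      intro i
      by_contra hne
      -- The computation consults finitely many positions, so some finite level of the path sees all
      -- reservoir elements used; each carries the color required by `γ k` on both right sides.
      have hall : ∀ᶠ n in atTop, ∀ l ∈ Finset.range t, l ∈ B → l ∈ S.lower k ∨
          ∃ n' < n, ∃ s, Y i s n' = S.γ k s ∧ position s (S.reservoir n' s) = l := by
        refine (Finset.eventually_all _).2 fun l _ => ?_
        by_cases hl : l ∈ B
        · rcases hB' l hl with h | ⟨s, n, h⟩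
          · exact Eventually.of_forall fun _ _ => Or.inl h
          · filter_upwards [eventually_gt_atTop (q s n)] with n' hn' _
            refine Or.inr ⟨_, hn', s, ?_, h.symm⟩
            rw [hk]
            fin_cases i
            · exact (hqs s n).2.1
            · exact (hqs s n).2.2
        · exact Eventually.of_forall fun _ h => absurd h hl
      obtain ⟨n, hn, hn1, hn2, hn3⟩ := (hall.and
        ((eventually_gt_atTop (encode (oracleSeg B t, m))).and
        ((eventually_ge_atTop t).and (eventually_gt_atTop m)))).exists
      -- An output of another color would be a witness at this level of the path.
      refine (hsol.isPath i n).2 k ⟨_, by rwa [length_initSeg], oracleSeg B t, m, rfl, ?_⟩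
      refine ⟨by simpa [length_initSeg] using hn2, hmN, ?_, ?_, ht, fun l hl => ?_⟩
      · simp [getElem?_initSeg _ hn3]
      · simpa [getElem?_initSeg _ hn3] using hne
      · rw [length_oracleSeg] at hl
        rw [getElem?_oracleSeg hl]
        refine ⟨fun h => by simpa using hB h, fun h => ?_⟩
        rcases hn l (Finset.mem_range.2 hl) (by simpa using h) with h | ⟨n', hn', s, h1, h2⟩
        · exact Or.inl h
        · refine Or.inr ⟨n', by rwa [length_initSeg], s, ?_, h2⟩
          rw [getElem?_initSeg _ hn', h1]
    exact Or.inr ⟨key 0, key 1⟩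

open Classical in
theorem exists_computableIn_blocked {O : Set (ℕ →. ℕ)}
    (hΦ : ∀ k, Primrec₂ (S.Φ k)) (hres : ComputableIn O S.reservoir)
    (hlow : ∀ k, ComputableIn O fun i => decide (i ∈ S.lower k))
    (hblocked : ∀ N, ∃ ρ, S.Blocked N ρ) :
    ∃ ρ : ℕ → List (Fin 3), ComputableIn O ρ ∧ ∀ N, S.Blocked N (ρ N) := by
  obtain ⟨ρ, hρ, hb⟩ := exists_computableIn_search (computableIn_blocked hΦ hres hlow)
    fun N => (hblocked N).imp fun ρ hρ => decide_eq_true hρ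
  exact ⟨ρ, hρ, fun N => of_decide_eq_true (hb N)⟩

/-- The positions above `N` at which the string has the value `j`. -/
def positions (ρ : List (Fin 3)) (N : ℕ) (j : Fin 3) : List ℕ :=
  (List.range ρ.length).filter fun m => N < m ∧ ρ[m]? = some j

theorem mem_positions {ρ : List (Fin 3)} {N : ℕ} {j : Fin 3} {m : ℕ} :
    m ∈ positions ρ N j ↔ N < m ∧ ρ[m]? = some j := by
  simp only [positions, List.mem_filter, List.mem_range, decide_eq_true_eq]
  exact ⟨fun h => h.2, fun h => ⟨(List.getElem?_eq_some_iff.1 h.2).1, h⟩⟩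

theorem primrec_positions :
    Primrec fun x : ℕ × Fin 3 × List (Fin 3) => positions x.2.2 x.1 x.2.1 := by
  have h1 : PrimrecRel fun (m : ℕ) (x : ℕ × Fin 3 × List (Fin 3)) =>
      x.1 < m ∧ x.2.2[m]? = some x.2.1 :=
    PrimrecPred.and (Primrec.nat_lt.comp (Primrec.fst.comp Primrec.snd) Primrec.fst)
      (Primrec.eq.comp (Primrec.list_getElem?.comp
        (Primrec.snd.comp (Primrec.snd.comp Primrec.snd)) Primrec.fst)
        (Primrec.option_some.comp (Primrec.fst.comp (Primrec.snd.comp Primrec.snd))))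
  have h2 : Primrec fun x : ℕ × Fin 3 × List (Fin 3) => List.range x.2.2.length :=
    Primrec.list_range.comp (Primrec.list_length.comp (Primrec.snd.comp Primrec.snd))
  exact (Primrec₂.comp h1.listFilter h2 Primrec.id).of_eq fun x => rfl

theorem computableIn₂_positions {O : Set (ℕ →. ℕ)} {ρ : ℕ → List (Fin 3)}
    (hρ : ComputableIn O ρ) : ComputableIn₂ O fun N j => positions (ρ N) N j := by
  have h1 := computableIn_primrec_comp primrec_positions
    (computableIn_pair (ComputableIn.fst (α := ℕ) (β := Fin 3))
      (computableIn_pair (ComputableIn.snd (α := ℕ) (β := Fin 3))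
        (computableIn_comp hρ (ComputableIn.fst (α := ℕ) (β := Fin 3)))))
  exact h1

open Classical in
/-- If for every `N` some left string is blocked, hyperimmunity provides finite subsets of the
reservoirs that make one of the functionals enumerate an element of the wrong color. -/
theorem exists_extension_of_blocked (hM : IsTuringIdeal M) {f : ℕ → Fin 3}
    (hf : ∀ D ∈ M, Hyperimmune f D)
    (hΦ : ∀ k, Primrec₂ (S.Φ k)) (hres : ComputableIn (chi '' M) S.reservoir)
    (hlow : ∀ k, ComputableIn (chi '' M) fun i => decide (i ∈ S.lower k))
    {A : Fin r → Fin 2 → Set ℕ} (hA : ∀ n s, ∃ c, S.reservoir n s ∈ A s c)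
    (hblocked : ∀ N, ∃ ρ, S.Blocked N ρ) :
    ∃ (k : Fin K) (E : Fin r → Finset ℕ) (b : ℕ),
      (∀ s, ∀ x ∈ E s, x ∈ A s (S.γ k s) ∧ ∃ n, S.reservoir n s = x) ∧
      ∀ B : Set ℕ, S.lower k ⊆ B → (∀ s, ∀ x ∈ E s, position s x ∈ B) →
        (∀ i ∈ B, i ∈ S.lower k ∨ (∃ s, ∃ x ∈ E s, i = position s x) ∨
          ∃ (s : Fin r) (x : ℕ), b ≤ x ∧ i = position s x) → ∃ m ∈ outputs (S.Φ k) B, f m ≠ S.j k := by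
  obtain ⟨ρ, hρ, hρb⟩ := exists_computableIn_blocked hΦ hres hlow hblocked
  obtain ⟨D, hD, harr⟩ := hM.exists_computableArray (computableIn₂_positions hρ)
  obtain ⟨N, hN⟩ := hf D hD _ harr
    (fun N i j hij => Finset.disjoint_left.2 fun m hi hj => hij (by
      have h1 := (mem_positions.1 (List.mem_toFinset.1 hi)).2
      have h2 := (mem_positions.1 (List.mem_toFinset.1 hj)).2
      exact Option.some_injective _ (h1.symm.trans h2)))
    (fun N j m hm => (mem_positions.1 (List.mem_toFinset.1 hm)).1)
  choose col hcol using hA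
  -- The blocked string is tested against the companion that records the true labels of the
  -- reservoir elements.
  obtain ⟨k, w, -, τ, m, -, -, hm, hne, hnj, hout, hτ⟩ := hρb N
    (fun s => (List.range (ρ N).length).map fun n => col n s)
    (mem_stringTuples.2 fun s => by simp)
  simp only at hne hnj hτ
  -- `E` collects the correctly labeled reservoir elements that `τ` says are in the oracle. With `b
  -- = τ.length`, later additions cannot disturb `τ` as an initial segment.
  refine ⟨k, fun s => ((Finset.range (ρ N).length).filter fun n => col n s = S.γ k s ∧
    τ[position s (S.reservoir n s)]? = some true).image fun n => S.reservoir n s, τ.length,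
    fun s x hx => ?_, fun B hB hE hB' => ⟨m, ⟨τ.length, ?_⟩, ?_⟩⟩
  · obtain ⟨n, hn, rfl⟩ := Finset.mem_image.1 hx
    refine ⟨?_, n, rfl⟩
    rw [← (Finset.mem_filter.1 hn).2.1]
    exact hcol n s
  · have hseg : oracleSeg B τ.length = τ := by
      refine List.ext_getElem (by simp) fun i h₁ h₂ => ?_
      have h3 : (oracleSeg B τ.length)[i] = decide (i ∈ B) := by
        simp [oracleSeg]
      have h4 : τ[i]? = some τ[i] := List.getElem?_eq_getElem h₂
      have h5 : τ[i] = true ↔ i ∈ B := by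
        constructor
        · intro h
          rw [h] at h4
          rcases (hτ i h₂).2 h4 with h6 | ⟨n, hn, s, hs, rfl⟩
          · exact hB h6
          · refine hE s _ (Finset.mem_image.2 ⟨n, ?_, rfl⟩)
            refine Finset.mem_filter.2 ⟨Finset.mem_range.2 hn, ?_, h4⟩
            simpa [hn] using hs
        · intro h
          have h6 : τ[i]? = some true := by
            rcases hB' i h with h | ⟨s, x, hx, rfl⟩ | ⟨s, x, hx, rfl⟩
            · exact (hτ i h₂).1 h
            · obtain ⟨n, hn, rfl⟩ := Finset.mem_image.1 hx
              exact (Finset.mem_filter.1 hn).2.2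
            -- The position of an element exceeds the element, so it lies beyond the end of `τ`.
            · have := le_position s x
              omega
          rw [h4] at h6
          exact Option.some_injective _ h6
      rw [h3]
      exact Bool.eq_iff_iff.2 (by simpa using h5.symm)
    rw [hseg]
    exact hout
  · obtain ⟨a, ha⟩ := Option.ne_none_iff_exists'.1 hne
    rw [hN a m (List.mem_toFinset.2 (mem_positions.2 ⟨hm, ha⟩))]
    rintro rfl
    exact hnj ha

end Task

/-! ### Joins with tuples of sets -/

section Join

variable {r : ℕ}

theorem position_mem_join {Z : Set ℕ} {G : Fin r → Set ℕ} {s : Fin r} {x : ℕ} :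
    position s x ∈ join Z (tupleJoin G) ↔ x ∈ G s := by
  rw [position, mul_two_add_one_mem_join]
  constructor
  · rintro ⟨t, y, hy, h⟩
    obtain ⟨h1, rfl⟩ := Nat.pair_eq_pair.1 h
    rwa [Fin.ext h1]
  · exact fun h => ⟨s, x, h, rfl⟩

theorem mem_join_tupleJoin {Z : Set ℕ} {G : Fin r → Set ℕ} {i : ℕ} :
    i ∈ join Z (tupleJoin G) ↔ (∃ z ∈ Z, i = 2 * z) ∨ ∃ s, ∃ x ∈ G s, i = position s x := by
  constructor
  · rintro (h | ⟨_, ⟨s, x, hx, rfl⟩, rfl⟩)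
    · exact Or.inl h
    · exact Or.inr ⟨s, x, hx, rfl⟩
  · rintro (h | ⟨s, x, hx, rfl⟩)
    · exact Or.inl h
    · exact position_mem_join.2 hx

theorem join_tupleJoin_mono {Z : Set ℕ} {G G' : Fin r → Set ℕ} (h : ∀ s, G s ⊆ G' s) :
    join Z (tupleJoin G) ⊆ join Z (tupleJoin G') := by
  intro i hi
  rw [mem_join_tupleJoin] at hi ⊢
  exact hi.imp_right fun ⟨s, x, hx, e⟩ => ⟨s, x, h s hx, e⟩

variable {M : Set (Set ℕ)}

theorem IsTuringIdeal.mem_of_finite (hM : IsTuringIdeal M) {A : Set ℕ} (hA : A.Finite) :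
    A ∈ M := by
  classical
  have h1 : PrimrecPred fun n => n ∈ A := by
    refine (PrimrecRel.comp (Primrec.eq (α := ℕ)).exists_mem_list
      (Primrec.const hA.toFinset.toList) Primrec.id).of_eq fun n => ?_
    simp
  have h2 := hM.setCode_mem (T := A) (h1.decide.computableIn)
  simpa [setCode] using h2

theorem IsTuringIdeal.join_tupleJoin_mem (hM : IsTuringIdeal M) {Z : Set ℕ} (hZ : Z ∈ M)
    (E : Fin r → Finset ℕ) : join Z (tupleJoin fun s => (E s : Set ℕ)) ∈ M := by
  refine hM.join_mem _ hZ _ (hM.mem_of_finite ?_)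
  refine (Set.finite_iUnion fun s : Fin r => (E s).finite_toSet.image (Nat.pair s)).subset ?_
  rintro _ ⟨s, x, hx, rfl⟩
  exact Set.mem_iUnion.2 ⟨s, x, hx, rfl⟩

end Join

/-! ### The forcing conditions and their density properties -/

/-- Mathias-style conditions: finite sets `F s c`, subsets of the sets `A s c` of numbers that may
be put into the `s`-th set of color `c`, and enumerations, computable in `O`, of the numbers that
may be added later. -/
structure Condition {r : ℕ} (O : Set (ℕ →. ℕ)) (R : Fin r → Set ℕ) (A : Fin r → Fin 2 → Set ℕ) where
  F : Fin r → Fin 2 → Finset ℕ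
  p : ℕ → Fin r → ℕ
  F_mem : ∀ s c, ∀ x ∈ F s c, x ∈ A s c
  computable : ComputableIn O p
  tendsto : ∀ s, Tendsto (fun n => p n s) atTop atTop
  p_mem : ∀ n s, p n s ∈ R s

namespace Condition

variable {r : ℕ} {O : Set (ℕ →. ℕ)} {R : Fin r → Set ℕ} {A : Fin r → Fin 2 → Set ℕ}

/-- Larger conditions are stronger, so dense families are cofinal ones. New elements come from the
old reservoir, and reservoirs only shrink. -/
instance : Preorder (Condition O R A) where
  le P Q := (∀ s c, ∀ x ∈ P.F s c, x ∈ Q.F s c) ∧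
    (∀ s c, ∀ x ∈ Q.F s c, x ∈ P.F s c ∨ ∃ n, P.p n s = x) ∧ ∀ n s, ∃ i, P.p i s = Q.p n s
  le_refl P := ⟨fun _ _ _ h => h, fun _ _ _ h => Or.inl h, fun n _ => ⟨n, rfl⟩⟩
  le_trans P Q T h h' := by
    refine ⟨fun s c x hx => h'.1 s c x (h.1 s c x hx), fun s c x hx => ?_, fun n s => ?_⟩
    · rcases h'.2.1 s c x hx with h1 | ⟨n, rfl⟩
      · exact h.2.1 s c x h1
      · exact Or.inr (h.2.2 n s)
    · obtain ⟨i, hi⟩ := h'.2.2 n s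
      rw [← hi]
      exact h.2.2 i s

/-- The tuple `G` satisfies the condition for the colors `c`. -/
def Allows (P : Condition O R A) (c : Fin r → Fin 2) (G : Fin r → Set ℕ) : Prop :=
  ∀ s, (∀ x ∈ P.F s (c s), x ∈ G s) ∧ ∀ x ∈ G s, x ∈ P.F s (c s) ∨ ∃ n, P.p n s = x

theorem computableIn_shift {α : Type*} [Primcodable α] {p : ℕ → α} (hp : ComputableIn O p)
    (b : ℕ) : ComputableIn O fun n => p (n + b) :=
  computableIn_comp hp (Primrec.nat_add.comp Primrec.id (Primrec.const b)).computableIn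

theorem exists_forall_le_shift (P : Condition O R A) (b : ℕ) :
    ∃ N, ∀ n s, b ≤ P.p (n + N) s := by
  have h : ∀ᶠ n in atTop, ∀ s, b ≤ P.p n s :=
    eventually_all.2 fun s => (P.tendsto s).eventually_ge_atTop b
  obtain ⟨N, hN⟩ := eventually_atTop.1 h
  exact ⟨N, fun n s => hN _ (by omega) s⟩

/-- The extension of a condition by finite subsets of the reservoirs and by thinner reservoirs. -/
def extend (P : Condition O R A) (E : Fin r → Fin 2 → Finset ℕ)
    (hE : ∀ s c, ∀ x ∈ E s c, x ∈ A s c) (q : ℕ → Fin r → ℕ) (hq : ComputableIn O q)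
    (hqt : ∀ s, Tendsto (fun n => q n s) atTop atTop) (hqp : ∀ n s, ∃ i, P.p i s = q n s) :
    Condition O R A where
  F s c := P.F s c ∪ E s c
  p := q
  F_mem s c x hx := (Finset.mem_union.1 hx).elim (P.F_mem s c x) (hE s c x)
  computable := hq
  tendsto := hqt
  p_mem n s := by
    obtain ⟨i, hi⟩ := hqp n s
    exact hi ▸ P.p_mem i s

theorem le_extend (P : Condition O R A) {E : Fin r → Fin 2 → Finset ℕ}
    {hE : ∀ s c, ∀ x ∈ E s c, x ∈ A s c} {q : ℕ → Fin r → ℕ} {hq : ComputableIn O q}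
    {hqt : ∀ s, Tendsto (fun n => q n s) atTop atTop} {hqp : ∀ n s, ∃ i, P.p i s = q n s}
    (hEp : ∀ s c, ∀ x ∈ E s c, ∃ n, P.p n s = x) : P ≤ P.extend E hE q hq hqt hqp :=
  ⟨fun _ _ _ h => Finset.mem_union_left _ h,
    fun s c x h => (Finset.mem_union.1 h).imp_right (hEp s c x), hqp⟩

/-- Conditions can be extended by large numbers of each color. -/
theorem isCofinal_large
    (hR : ∀ s, ∀ q : ℕ → ℕ, ComputableIn O q → Tendsto q atTop atTop → (∀ n, q n ∈ R s) →
      ∀ c, ∃ n, q n ∈ A s c) (s : Fin r) (c : Fin 2) (b : ℕ) :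
    IsCofinal {P : Condition O R A | ∃ x ∈ P.F s c, b ≤ x} := by
  intro P
  obtain ⟨N, hN⟩ := P.exists_forall_le_shift b
  obtain ⟨n, hn⟩ := hR s (fun n => P.p (n + N) s)
    (computableIn_primrec_comp (f := fun v : Fin r → ℕ => v s)
      (Primrec.fin_app.comp Primrec.id (Primrec.const s)) (computableIn_shift P.computable N))
    ((P.tendsto s).comp (tendsto_add_atTop_nat N)) (fun n => P.p_mem _ s) c
  let E : Fin r → Fin 2 → Finset ℕ := fun s' c' =>
    if s' = s ∧ c' = c then {P.p (n + N) s} else ∅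
  have hEmem : ∀ s' c' x, x ∈ E s' c' → s' = s ∧ c' = c ∧ x = P.p (n + N) s := by
    intro s' c' x hx
    by_cases h : s' = s ∧ c' = c
    · exact ⟨h.1, h.2, by simpa [E, h] using hx⟩
    · simp [E, h] at hx
  refine ⟨P.extend E ?_ P.p P.computable P.tendsto (fun n s => ⟨n, rfl⟩), ?_, P.le_extend ?_⟩
  · intro s' c' x hx
    obtain ⟨rfl, rfl, rfl⟩ := hEmem _ _ _ hx
    exact hn
  · exact ⟨P.p (n + N) s, Finset.mem_union_right _ (by simp [E]), hN n s⟩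
  · intro s' c' x hx
    obtain ⟨rfl, -, rfl⟩ := hEmem _ _ _ hx
    exact ⟨_, rfl⟩

/-- The main density property: given a functional for each tuple of colors, conditions can be
extended so that one of the functionals does not enumerate an infinite set of the given color. -/
theorem isCofinal_outputs {M : Set (Set ℕ)} (hM : IsCrossConstraintIdeal r M) {f : ℕ → Fin 3}
    (hf : ∀ D ∈ M, Hyperimmune f D) (hRA : ∀ s, ∀ x ∈ R s, ∃ c, x ∈ A s c)
    (Φ : (Fin r → Fin 2) → List Bool → ℕ → Option ℕ) (hΦ : ∀ c, Primrec₂ (Φ c))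
    (Z : (Fin r → Fin 2) → Set ℕ) (hZ : ∀ c, Z c ∈ M) (j : (Fin r → Fin 2) → Fin 3) :
    IsCofinal {P : Condition (chi '' M) R A | ∃ c, ∀ G, P.Allows c G →
      ¬ ((outputs (Φ c) (join (Z c) (tupleJoin G))).Infinite ∧
        ∀ m ∈ outputs (Φ c) (join (Z c) (tupleJoin G)), f m = j c)} := by
  intro P
  let e := Fintype.equivFin (Fin r → Fin 2)
  let S : Task r (Fintype.card (Fin r → Fin 2)) :=
    { reservoir := P.p
      γ := e.symm
      Φ := fun k => Φ (e.symm k)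
      j := fun k => j (e.symm k)
      lower := fun k => join (Z (e.symm k))
        (tupleJoin fun s => (P.F s (e.symm k s) : Set ℕ)) }
  have hlow : ∀ k, S.lower k ∈ M := fun k => hM.isTuringIdeal.join_tupleJoin_mem (hZ _) _
  have hallows : ∀ (k) {Q : Condition (chi '' M) R A} {G : Fin r → Set ℕ}, P ≤ Q →
      Q.Allows (S.γ k) G → S.lower k ⊆ join (Z (S.γ k)) (tupleJoin G) := by
    intro k Q G hPQ hG
    exact join_tupleJoin_mono fun s x hx => (hG s).1 x (hPQ.1 _ _ _ hx)
  -- One left-full tree suffices for thinning the reservoirs; hyperimmunity needs a blocked string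
  -- for every `N`.
  by_cases hfull : ∃ N, LeftFull (S.tree N)
  · obtain ⟨N, hN⟩ := hfull
    obtain ⟨k, q, hq, hqt, hqp, hout⟩ := Task.exists_reservoir_of_leftFull hM
      (S := S) (fun k => hΦ _) P.computable (fun k => computableIn_mem (hlow k)) P.tendsto
      e.symm.surjective hN
    have hle := P.le_extend (E := fun _ _ => ∅) (hE := by simp) (hq := hq) (hqt := hqt)
      (hqp := fun n s => (hqp n s).imp fun i hi => hi.symm) (by simp)
    refine ⟨_, ⟨S.γ k, fun G hG h => h.1 (hout _ (hallows k hle hG) fun i hi => ?_)⟩, hle⟩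
    rcases mem_join_tupleJoin.1 hi with ⟨z, hz, rfl⟩ | ⟨s, x, hx, rfl⟩
    · exact Or.inl (mul_two_mem_join.2 hz)
    · rcases (hG s).2 x hx with h | ⟨n, rfl⟩
      · refine Or.inl (position_mem_join.2 ?_)
        simpa [extend] using h
      · exact Or.inr ⟨s, n, rfl⟩
  · push Not at hfull
    obtain ⟨k, E, b, hE, hout⟩ := Task.exists_extension_of_blocked hM.isTuringIdeal hf
      (S := S) (fun k => hΦ _) P.computable (fun k => computableIn_mem (hlow k))
      (fun n s => hRA s _ (P.p_mem n s))
      (fun N => (S.leftFull_or_blocked N).resolve_left (hfull N))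
    obtain ⟨N, hN⟩ := P.exists_forall_le_shift b
    -- Only the finite sets with the labels `γ k` grow; the reservoirs are shifted past `b` to
    -- preserve the computation.
    let E' : Fin r → Fin 2 → Finset ℕ := fun s c => if c = S.γ k s then E s else ∅
    have hE' : ∀ s c x, x ∈ E' s c → c = S.γ k s ∧ x ∈ E s := by
      intro s c x hx
      by_cases h : c = S.γ k s
      · exact ⟨h, by simpa [E', h] using hx⟩
      · simp [E', h] at hx
    have hle := P.le_extend (E := E') (q := fun n => P.p (n + N))
      (hE := fun s c x hx => by
        obtain ⟨rfl, h⟩ := hE' s c x hx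
        exact (hE s x h).1)
      (hq := computableIn_shift P.computable N)
      (hqt := fun s => (P.tendsto s).comp (tendsto_add_atTop_nat N))
      (hqp := fun n s => ⟨_, rfl⟩) (fun s c x hx => (hE s x (hE' s c x hx).2).2)
    refine ⟨_, ⟨S.γ k, fun G hG h => ?_⟩, hle⟩
    obtain ⟨m, hm, hne⟩ := hout _ (hallows k hle hG)
      (fun s x hx => position_mem_join.2
        ((hG s).1 x (Finset.mem_union_right _ (by simpa [E'] using hx))))
      (fun i hi => by
        rcases mem_join_tupleJoin.1 hi with ⟨z, hz, rfl⟩ | ⟨s, x, hx, rfl⟩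
        · exact Or.inl (mul_two_mem_join.2 hz)
        · rcases (hG s).2 x hx with h | ⟨n, rfl⟩
          · rcases Finset.mem_union.1 h with h | h
            · exact Or.inl (position_mem_join.2 h)
            · exact Or.inr (Or.inl ⟨s, x, (hE' _ _ _ h).2, rfl⟩)
          · exact Or.inr (Or.inr ⟨s, _, hN n s, rfl⟩))
    exact hne (h.2 m hm)

end Condition

/-! ### Initial reservoirs -/

/-- For each `2`-coloring there are a reservoir and, for both colors, homogeneous sets that cover
the reservoir and meet all of its subsets with an enumeration that is computable in `O`. -/
theorem exists_reservoir (O : Set (ℕ →. ℕ)) (g : ℕ → Fin 2) :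
    ∃ (R : Set ℕ) (A : Fin 2 → Set ℕ) (p : ℕ → ℕ), ComputableIn O p ∧ Tendsto p atTop atTop ∧
      (∀ n, p n ∈ R) ∧ (∀ x ∈ R, ∃ c, x ∈ A c) ∧ (∀ c, ∃ i, ∀ x ∈ A c, g x = i) ∧
      ∀ q : ℕ → ℕ, ComputableIn O q → Tendsto q atTop atTop → (∀ n, q n ∈ R) →
        ∀ c, ∃ n, q n ∈ A c := by
  -- Either some color class contains an unbounded computable sequence, which serves as reservoir,
  -- or every such sequence meets both classes.
  by_cases h : ∃ p : ℕ → ℕ, ComputableIn O p ∧ Tendsto p atTop atTop ∧ ∃ i, ∀ n, g (p n) = i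
  · obtain ⟨p, hp, hpt, i, hi⟩ := h
    -- Both labels stand for the same color class, so either choice of label can be fulfilled.
    refine ⟨Set.range p, fun _ => {x | g x = i}, p, hp, hpt, fun n => ⟨n, rfl⟩, ?_,
      fun _ => ⟨i, fun _ h => h⟩, fun q _ _ hq _ => ⟨0, ?_⟩⟩
    · rintro _ ⟨n, rfl⟩
      exact ⟨0, hi n⟩
    · obtain ⟨n, hn⟩ := hq 0
      exact hn ▸ hi n
  · refine ⟨Set.univ, fun c => {x | g x = c}, id, ComputableIn.id, tendsto_id,
      fun _ => Set.mem_univ _, fun x _ => ⟨g x, rfl⟩, fun c => ⟨c, fun _ h => h⟩,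
      fun q hq hqt _ c => ?_⟩
    by_contra hc
    push Not at hc
    -- With two colors, a sequence that avoids `c` is constantly of the other color.
    refine h ⟨q, hq, hqt, 1 - c, fun n => ?_⟩
    have : g (q n) ≠ c := hc n
    omega

end CrossConstraint

/-! ### The generic construction -/

theorem mainTheorem4 (r : ℕ) (M : Set (Set ℕ)) (hM : M.Countable)
    (hCC : CrossConstraint.IsCrossConstraintIdeal r M)
    (f : ℕ → Fin 3) (hf : ∀ D ∈ M, CrossConstraint.Hyperimmune f D)
    (g : Fin r → ℕ → Fin 2) :
    ∃ G : Fin r → Set ℕ,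
      (∀ s, (G s).Infinite ∧ CrossConstraint.Homogeneous (g s) (G s)) ∧
      ∀ Z ∈ M, ¬ ∃ H : Set ℕ, H.Infinite ∧ CrossConstraint.Homogeneous f H ∧
        CrossConstraint.ComputableFrom H
          (CrossConstraint.join Z (CrossConstraint.tupleJoin G)) := by
  open CrossConstraint in
  choose R A p hp hpt hpR hRA hA hR using fun s => exists_reservoir (chi '' M) (g s)
  let P₀ : Condition (chi '' M) R A :=
    { F := fun _ _ => ∅
      p := fun n s => p s n
      F_mem := by simp
      computable := computableIn_finArrow hp
      tendsto := hpt
      p_mem := fun n s => hpR s n }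
  have : Countable {Φ : List Bool → ℕ → Option ℕ // Primrec₂ Φ} := countable_primrec₂.to_subtype
  have : Countable M := hM.to_subtype
  -- The left summand makes the sets infinite. An index in the right summand assigns a triple to
  -- every tuple of labels; there are countably many since there are finitely many tuples.
  let ι := (Fin r × Fin 2 × ℕ) ⊕
    ((Fin r → Fin 2) → {Φ : List Bool → ℕ → Option ℕ // Primrec₂ Φ} × M × Fin 3)
  have : Encodable ι := Encodable.ofCountable ι
  let 𝒟 : ι → Order.Cofinal (Condition (chi '' M) R A) := Sum.elim
    (fun t => ⟨_, Condition.isCofinal_large hR t.1 t.2.1 t.2.2⟩)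
    (fun t => ⟨_, Condition.isCofinal_outputs hCC hf hRA (fun c => (t c).1.1)
      (fun c => (t c).1.2) (fun c => (t c).2.1) (fun c => (t c).2.1.2) fun c => (t c).2.2⟩)
  let Q := Order.sequenceOfCofinals P₀ 𝒟
  have hQ : Monotone Q := Order.sequenceOfCofinals.monotone P₀ 𝒟
  have hmem : ∀ i : ι, Q (Encodable.encode i + 1) ∈ 𝒟 i :=
    Order.sequenceOfCofinals.encode_mem P₀ 𝒟
  let G : (Fin r → Fin 2) → Fin r → Set ℕ := fun c s => {x | ∃ n, x ∈ (Q n).F s (c s)}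
  have hallows : ∀ n c, (Q n).Allows c (G c) := by
    refine fun n c s => ⟨fun x hx => ⟨n, hx⟩, ?_⟩
    rintro x ⟨m, hm⟩
    rcases le_total m n with h | h
    · exact Or.inl ((hQ h).1 _ _ _ hm)
    · exact (hQ h).2.1 _ _ _ hm
  have hinf : ∀ c s, (G c s).Infinite := by
    intro c s
    refine Set.infinite_of_forall_exists_gt fun b => ?_
    -- The bound `b + 1` turns the weak inequality of the density property into a strict one.
    obtain ⟨x, hx, hb⟩ := hmem (Sum.inl (s, c s, b + 1))
    exact ⟨x, ⟨_, hx⟩, hb⟩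
  have hhom : ∀ c s, Homogeneous (g s) (G c s) := by
    intro c s
    obtain ⟨i, hi⟩ := hA s (c s)
    refine ⟨i, ?_⟩
    rintro x ⟨n, hx⟩
    exact hi x ((Q n).F_mem _ _ _ hx)
  by_contra hcon
  have hbad : ∀ c, ∃ t : {Φ : List Bool → ℕ → Option ℕ // Primrec₂ Φ} × M × Fin 3,
      (outputs t.1.1 (join t.2.1 (tupleJoin (G c)))).Infinite ∧
        ∀ m ∈ outputs t.1.1 (join t.2.1 (tupleJoin (G c))), f m = t.2.2 := by
    intro c
    by_contra hc
    refine hcon ⟨G c, fun s => ⟨hinf c s, hhom c s⟩, ?_⟩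
    rintro Z hZ ⟨H, hH, ⟨i, hi⟩, hcomp⟩
    obtain ⟨Φ, hΦ, rfl⟩ := exists_outputs_eq hcomp
    exact hc ⟨(⟨Φ, hΦ⟩, ⟨Z, hZ⟩, i), hH, hi⟩
  choose t ht using hbad
  -- The chosen failures form a single index `t`, whose requirement was met at some `c`.
  obtain ⟨c, hc⟩ := hmem (Sum.inr t)
  exact hc (G c) (hallows _ c) (ht c)
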